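/- Let $n\ge 1$, let $e_{n+1}$ be the last standard basis vector of $\mathbb R^{n+1}$, and let $S^n_-=\{u\in S^n:\langle u,e_{n+1}\rangle<0\}$. Write $V$ for Lebesgue measure on $\mathbb R^{n+1}$ and $\mathcal H^n$ for the $n$-dimensional Hausdorff measure (normalised to agree with Lebesgue measure on $n$-dimensional subspaces), and $h_K(u)=\sup_{x\in K}\langle x,u\rangle$. For a convex set $K\subseteq\mathbb R^{n+1}$ and $t>0$ let $\mathsf A_t(K)$ be the set of all $y$ with $0\le\langle y,e_{n+1}\rangle\le t$ that lie in every supporting half-space of $K$ at every point $x\in\partial K$ with $\langle x,e_{n+1}\rangle=t$. Put $\mathsf A(K)=\overline{\bigcup_{t>0}\mathsf A_t(K)}$ and $K^c=\mathsf A(K)\setminus K$. The surface area measure of $K$ is $S(K,\Sigma)=\mathcal H^n(\{x\in\partial K: g(x)\in\Sigma\})$ for Borel $\Sigma\subseteq S^n$, where $g$ is the Gauss map, defined at the points of $\partial K$ that have exactly one unit outer normal vector. Let $D\subseteq S^n_-$ be a convex domain (relatively open in $S^n$, with $\{x\neq 0: x/\|x\|\in D\}\cup\{0\}$ convex). Let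 $K\in\mathcal C_b(D)$; that is, $K\subseteq\{x:\langle x,e_{n+1}\rangle\ge 0\}$ is a non-compact convex set with non-empty interior and with the origin on its boundary, $\mathsf A(K)\cap\{x:\langle x,e_{n+1}\rangle=0\}$ is compact, $h_K$ is finite on $D$, and $V(K^c)<\infty$. Let $\omega\subseteq D$ be compact with $h_K>0$ on $\omega$, and let $f:\omega\to\mathbb R$ be continuous. For $\tau\in\mathbb R$ put $$K_\tau=\mathsf A(K)\cap\bigcap_{u\in\omega}\{x:\langle x,u\rangle\le h_K(u)+\tau f(u)\},\qquad K_\omega=\mathsf A(K)\cap\bigcap_{u\in\omega}\{x:\langle x,u\rangle\le h_K(u)\}.$$ Then $V(K_\omega^c)<\infty$, $V(K_\tau^c)<\infty$ for all $\tau$ sufficiently close to $0$, $f$ is integrable on $\omega$ with respect to $S(K_\omega,\cdot)$, and $\tau\mapsto V(K_\tau^c)$ is differentiable at $\tau=0$ with $$\frac{d}{d\tau}V(K_\tau^c)\Big|_{\tau=0}=\lim_{\tau\to0}\frac{V(K_\tau^c)-V(K_\omega^c)}{\tau}=-\int_\omega f(u)\,dS(K_\omega,u).$$ -/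

import Mathlib

open MeasureTheory Filter Topology
open scoped RealInnerProductSpace

namespace Coconvex

/-- The ambient Euclidean space `ℝⁿ⁺¹`. -/
abbrev Space (n : ℕ) : Type := EuclideanSpace ℝ (Fin (n + 1))

/-- The height `⟨x, eₙ₊₁⟩`, that is, the last coordinate. -/
def height {n : ℕ} (x : Space n) : ℝ := x (Fin.last n)

/-- The open lower hemisphere `Sⁿ₋`. -/
def lowerHemisphere (n : ℕ) : Set (Space n) := {u | ‖u‖ = 1 ∧ height u < 0}

/-- `u` is a unit outer normal vector of `K` at `x`: the half-space `{z | ⟨z, u⟩ ≤ ⟨x, u⟩}`,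
whose bounding hyperplane passes through `x`, contains `K`. -/
def IsUnitNormal {n : ℕ} (K : Set (Space n)) (x u : Space n) : Prop :=
  ‖u‖ = 1 ∧ ∀ z ∈ K, ⟪z, u⟫ ≤ ⟪x, u⟫

/-- The support function `h_K(u) = sup {⟨x, u⟩ | x ∈ K}`; it is only used at `u` where the
supremum is finite. -/
noncomputable def supportFun {n : ℕ} (K : Set (Space n)) (u : Space n) : ℝ :=
  sSup ((fun x => ⟪x, u⟫) '' K)

/-- The `t`-asymptotic boundary set `A_t(K)`: the slab `0 ≤ ⟨y, eₙ₊₁⟩ ≤ t` intersected with all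
supporting half-spaces of `K` at boundary points of height `t`. -/
def asymptoticSetAt {n : ℕ} (K : Set (Space n)) (t : ℝ) : Set (Space n) :=
  {y | 0 ≤ height y ∧ height y ≤ t ∧
    ∀ x ∈ frontier K, height x = t → ∀ u, IsUnitNormal K x u → ⟪y, u⟫ ≤ ⟪x, u⟫}

/-- The asymptotic boundary set `A(K)`, the closure of `⋃_{t > 0} A_t(K)`. -/
def asymptoticSet {n : ℕ} (K : Set (Space n)) : Set (Space n) :=
  closure (⋃ t ∈ Set.Ioi (0 : ℝ), asymptoticSetAt K t)

/-- `Kᶜ = A(K) \ K`. -/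
def coconvexSet {n : ℕ} (K : Set (Space n)) : Set (Space n) := asymptoticSet K \ K

/-- The class `𝒞₀`: non-compact convex sets in the closed upper half-space, with the origin on the
boundary and with non-empty interior. -/
structure MemC0 {n : ℕ} (K : Set (Space n)) : Prop where
  convex : Convex ℝ K
  not_compact : ¬ IsCompact K
  height_nonneg : ∀ x ∈ K, 0 ≤ height x
  zero_mem_frontier : (0 : Space n) ∈ frontier K
  interior_nonempty : (interior K).Nonempty

/-- The class `𝒞_c`: members of `𝒞₀` with `A(K) ∩ {height = 0}` compact. -/
structure MemCc {n : ℕ} (K : Set (Space n)) : Prop extends MemC0 K where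
  compact_base : IsCompact (asymptoticSet K ∩ {x | height x = 0})

/-- `D` is a convex domain in `Sⁿ₋`: relatively open in the sphere, contained in `Sⁿ₋`, and
the cone spanned by it is convex. -/
structure IsConvexDomain {n : ℕ} (D : Set (Space n)) : Prop where
  subset_lower : D ⊆ lowerHemisphere n
  rel_open : ∃ U : Set (Space n), IsOpen U ∧ D = U ∩ Metric.sphere 0 1
  convex_cone : Convex ℝ ({x : Space n | ‖x‖⁻¹ • x ∈ D} ∪ {0})

/-- The class `𝒞_c(D)`: members of `𝒞_c` whose support function is defined (finite) on the convex
domain `D ⊆ Sⁿ₋`. -/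
structure MemCcOn {n : ℕ} (D K : Set (Space n)) : Prop extends MemCc K where
  domain : IsConvexDomain D
  support_finite : ∀ u ∈ D, BddAbove ((fun x => ⟪x, u⟫) '' K)

/-- The class `𝒞_b(D)`: members of `𝒞_c(D)` for which `A(K) \ K` has finite volume. -/
structure MemCb {n : ℕ} (D K : Set (Space n)) : Prop extends MemCcOn D K where
  finite_covolume : volume (coconvexSet K) < ⊤

/-- `A(K) ∩ ⋂_{u ∈ ω} {x | ⟨x, u⟩ ≤ g(u)}`. -/
def wulffIn {n : ℕ} (K ω : Set (Space n)) (g : Space n → ℝ) : Set (Space n) :=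
  asymptoticSet K ∩ ⋂ u ∈ ω, {x | ⟪x, u⟫ ≤ g u}

/-- `K_ω`, the set `wulffIn` for the support function of `K`. -/
noncomputable def wulffBase {n : ℕ} (K ω : Set (Space n)) : Set (Space n) :=
  wulffIn K ω (supportFun K)

/-- `K_τ`, the set `wulffIn` for `h_K + τ f`. -/
noncomputable def wulffVar {n : ℕ} (K ω : Set (Space n)) (f : Space n → ℝ) (τ : ℝ) :
    Set (Space n) :=
  wulffIn K ω (fun u => supportFun K u + τ * f u)

/-- The boundary points of `K` with exactly one unit outer normal vector. -/
def regularBoundary {n : ℕ} (K : Set (Space n)) : Set (Space n) :=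
  {x | x ∈ frontier K ∧ ∃! u, IsUnitNormal K x u}

open Classical in
/-- The Gauss map: the unique unit outer normal at a regular boundary point (`0` elsewhere). -/
noncomputable def gaussMap {n : ℕ} (K : Set (Space n)) (x : Space n) : Space n :=
  if h : x ∈ regularBoundary K then h.2.choose else 0

/-- The surface area measure `S(K, ·)`: the image under the Gauss map of the `n`-dimensional
Hausdorff measure on `∂K`. Here `μHE[n]` is normalised so that it agrees with Lebesgue measure on
`n`-dimensional subspaces. -/
noncomputable def surfaceAreaMeasure {n : ℕ} (K : Set (Space n)) : Measure (Space n) :=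
  Measure.map (gaussMap K) ((μHE[n] : Measure (Space n)).restrict (regularBoundary K))

theorem gaussMap_isUnitNormal {n : ℕ} {K : Set (Space n)} {x : Space n}
    (h : x ∈ regularBoundary K) : IsUnitNormal K x (gaussMap K x) := by
  unfold gaussMap
  rw [dif_pos h]
  exact h.2.choose_spec.1

theorem gaussMap_eq_of_isUnitNormal {n : ℕ} {K : Set (Space n)} {x u : Space n}
    (h : x ∈ regularBoundary K) (hu : IsUnitNormal K x u) : gaussMap K x = u :=
  h.2.unique (gaussMap_isUnitNormal h) hu

theorem isClosed_isUnitNormal {n : ℕ} (K : Set (Space n)) :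
    IsClosed {p : Space n × Space n | IsUnitNormal K p.1 p.2} := by
  have : {p : Space n × Space n | IsUnitNormal K p.1 p.2} =
      {p | ‖p.2‖ = 1} ∩ ⋂ z ∈ K, {p | ⟪z, p.2⟫ ≤ ⟪p.1, p.2⟫} := by
    ext p; simp [IsUnitNormal]
  rw [this]
  refine (isClosed_eq (by fun_prop) (by fun_prop)).inter ?_
  exact isClosed_biInter fun z _ => isClosed_le (by fun_prop) (by fun_prop)

theorem isClosed_normal_mem {n : ℕ} (K F : Set (Space n)) (hF : IsClosed F) :
    IsClosed {x : Space n | ∃ u ∈ F, IsUnitNormal K x u} := by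
  have hZ : IsClosed {p : Space n × Metric.sphere (0 : Space n) 1 |
      (p.2 : Space n) ∈ F ∧ IsUnitNormal K p.1 p.2} :=
    (hF.preimage (by fun_prop : Continuous
      fun p : Space n × Metric.sphere (0 : Space n) 1 => (p.2 : Space n))).inter
    ((isClosed_isUnitNormal K).preimage (by fun_prop : Continuous
      fun p : Space n × Metric.sphere (0 : Space n) 1 => (p.1, (p.2 : Space n))))
  convert isClosedMap_fst_of_compactSpace _ hZ using 1
  ext x
  constructor
  · rintro ⟨u, hu, hn⟩
    exact ⟨(x, ⟨u, by simpa using hn.1⟩), ⟨hu, hn⟩, rfl⟩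
  · rintro ⟨p, ⟨h1, h2⟩, rfl⟩
    exact ⟨_, h1, h2⟩

theorem isClosed_two_normals {n : ℕ} (K : Set (Space n)) (ε : ℝ) :
    IsClosed {x : Space n | ∃ u v, IsUnitNormal K x u ∧ IsUnitNormal K x v ∧ ε ≤ dist u v} := by
  have hZ : IsClosed {p : Space n × (Metric.sphere (0 : Space n) 1 × Metric.sphere (0 : Space n) 1) | IsUnitNormal K p.1 p.2.1 ∧
      IsUnitNormal K p.1 p.2.2 ∧ ε ≤ dist (p.2.1 : Space n) p.2.2} :=
    ((isClosed_isUnitNormal K).preimage (by fun_prop : Continuous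
      fun p : Space n × (Metric.sphere (0 : Space n) 1 × Metric.sphere (0 : Space n) 1) => (p.1, (p.2.1 : Space n)))).inter
    (((isClosed_isUnitNormal K).preimage (by fun_prop : Continuous
      fun p : Space n × (Metric.sphere (0 : Space n) 1 × Metric.sphere (0 : Space n) 1) => (p.1, (p.2.2 : Space n)))).inter
      (isClosed_le continuous_const (by fun_prop : Continuous
        fun p : Space n × (Metric.sphere (0 : Space n) 1 × Metric.sphere (0 : Space n) 1) =>
          dist (p.2.1 : Space n) p.2.2)))
  convert isClosedMap_fst_of_compactSpace _ hZ using 1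
  ext x
  constructor
  · rintro ⟨u, v, hu, hv, h⟩
    exact ⟨(x, (⟨u, by simpa using hu.1⟩, ⟨v, by simpa using hv.1⟩)), ⟨hu, hv, h⟩, rfl⟩
  · rintro ⟨p, ⟨h1, h2, h3⟩, rfl⟩
    exact ⟨_, _, h1, h2, h3⟩

theorem measurableSet_regularBoundary {n : ℕ} (K : Set (Space n)) :
    MeasurableSet (regularBoundary K) := by
  have : regularBoundary K =
      (frontier K ∩ {x : Space n | ∃ u ∈ Set.univ, IsUnitNormal K x u}) \
        ⋃ k : ℕ, {x : Space n | ∃ u v, IsUnitNormal K x u ∧ IsUnitNormal K x v ∧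
          1 / ((k : ℝ) + 1) ≤ dist u v} := by
    ext x
    simp only [regularBoundary, Set.mem_ofPred_eq, Set.mem_sdiff, Set.mem_inter_iff, Set.mem_iUnion,
      Set.mem_univ, true_and]
    constructor
    · rintro ⟨hx, u, hu, huniq⟩
      refine ⟨⟨hx, u, hu⟩, ?_⟩
      rintro ⟨k, a, b, ha, hb, h⟩
      rw [huniq a ha, huniq b hb, dist_self] at h
      have : 0 < 1 / ((k : ℝ) + 1) := by positivity
      linarith
    · rintro ⟨⟨hx, u, hu⟩, hno⟩
      refine ⟨hx, u, hu, fun v hv => ?_⟩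
      by_contra hne
      obtain ⟨k, hk⟩ := exists_nat_one_div_lt (dist_pos.2 hne)
      exact hno ⟨k, v, u, hv, hu, hk.le⟩
  rw [this]
  exact (isClosed_frontier.measurableSet.inter
    (isClosed_normal_mem K _ isClosed_univ).measurableSet).diff
    (MeasurableSet.iUnion fun k => (isClosed_two_normals K _).measurableSet)

theorem measurable_gaussMap {n : ℕ} (K : Set (Space n)) : Measurable (gaussMap K) := by
  refine measurable_of_isClosed fun F hF => ?_
  have : gaussMap K ⁻¹' F =
      (regularBoundary K ∩ {x : Space n | ∃ u ∈ F, IsUnitNormal K x u}) ∪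
        ((regularBoundary K)ᶜ ∩ {_x : Space n | (0 : Space n) ∈ F}) := by
    ext x
    by_cases hx : x ∈ regularBoundary K
    · simp only [Set.mem_preimage, Set.mem_union, Set.mem_inter_iff, hx, true_and,
        Set.mem_compl_iff, not_true_eq_false, false_and, or_false, Set.mem_ofPred_eq]
      exact ⟨fun h => ⟨_, h, gaussMap_isUnitNormal hx⟩,
        fun ⟨u, hu, hn⟩ => by rwa [gaussMap_eq_of_isUnitNormal hx hn]⟩
    · simp [gaussMap, hx]
  rw [this]
  exact ((measurableSet_regularBoundary K).inter (isClosed_normal_mem K F hF).measurableSet).union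
    ((measurableSet_regularBoundary K).compl.inter (MeasurableSet.const _))

/-- `S(K, Σ) = ℋⁿ {x ∈ ∂K regular | g(x) ∈ Σ}` for Borel sets `Σ`. -/
theorem surfaceAreaMeasure_apply {n : ℕ} (K s : Set (Space n)) (hs : MeasurableSet s) :
    surfaceAreaMeasure K s =
      (μHE[n] : Measure (Space n)) {x | x ∈ regularBoundary K ∧ gaussMap K x ∈ s} := by
  unfold surfaceAreaMeasure
  rw [Measure.map_apply (measurable_gaussMap K) hs,
    Measure.restrict_apply (measurable_gaussMap K hs)]
  congr 1
  ext x
  exact and_comm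

end Coconvex

/-! Write ℝⁿ⁺¹ = ℝⁿ × ℝ. The directions in the compact set ω have last coordinate bounded away from
0 from below, so ⋂_{u ∈ ω} {⟨·, u⟩ ≤ g(u)} is the epigraph of a Lipschitz function G_g on ℝⁿ, a
maximum of affine functions (`lowerGraph`). Write G_τ for g = h_K + τf and G for G_0. If A(K_τ) =
A(K), then K_τᶜ is the part of A(K) strictly below the graph of G_τ, and Fubini gives V(K_τᶜ) = ∫
|{z < G_τ(x) : (x, z) ∈ A(K)}| dx. The theorem follows by differentiating under this integral.

Geometry of A(K). Compactness of the base forces every recession direction θ of A(K) to have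
positive height. Finite covolume and openness of D force ⟨θ, u⟩ < 0 for u ∈ D
(`MemCb.inner_neg_of_isRecession`). Hence constraints from ω with non-negative right-hand sides cut
A(K) only in a bounded region. The decisive fact is `MemCc.exists_normal_orthogonal_recession`: at a
boundary point of positive height, A(K) has a normal orthogonal to some recession direction. It
yields `MemCc.asymptoticSet_eq`, so that A(K_τ) = A(K), and it makes the boundary of A(K)
transversal to the graph of G.

Derivative. Where G is differentiable, the maximising u is unique and equals the downward unit
normal N, so an envelope argument gives ∂_τ G_τ = -f(N)√(1 + |∇G|²) at τ = 0
(`hasDerivAt_lowerGraph`). The length of the vertical section grows at the rate of G_τ where the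
graph of G runs inside int A(K), and is locally constant where the graph lies outside A(K). The
graph meets ∂A(K) only over a null set (`MemCb.volume_graphMap_frontier`). The graph is Lipschitz in
τ uniformly in x, and the integrand vanishes off a fixed ball, which gives domination.

Identification. Up to a null set, the boundary points of K_ω with normal in ω are the graph points
in int A(K). The area formula for Lipschitz graphs (`comap_graphMap_euclideanHausdorffMeasure`)
therefore turns ∫_ω f dS into the integral of f(N)√(1 + |∇G|²) over the corresponding base points.
-/

namespace Coconvex

open scoped ENNReal NNReal

/-! ### Coordinates: horizontal part and height. -/

/-- The horizontal factor `ℝⁿ` of `ℝⁿ⁺¹ = ℝⁿ × ℝ`. -/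
abbrev Base (n : ℕ) : Type := EuclideanSpace ℝ (Fin n)

/-- The point of `ℝⁿ⁺¹` with given horizontal part and height. -/
noncomputable def join {n : ℕ} : (Base n × ℝ) ≃L[ℝ] Space n :=
  LinearEquiv.toContinuousLinearEquiv
    { toFun := fun p => WithLp.toLp 2 (Fin.snoc (α := fun _ => ℝ) (fun i => p.1 i) p.2)
      invFun := fun x => (WithLp.toLp 2 (fun i => x i.castSucc), x (Fin.last n))
      map_add' := fun p q => by
        ext i
        refine Fin.lastCases ?_ (fun j => ?_) i <;> simp
      map_smul' := fun c p => by
        ext i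
        refine Fin.lastCases ?_ (fun j => ?_) i <;> simp
      left_inv := fun p => by
        refine Prod.ext ?_ ?_
        · ext i; simp
        · simp
      right_inv := fun x => by
        ext i
        refine Fin.lastCases ?_ (fun j => ?_) i <;> simp }

theorem join_last {n : ℕ} (p : Base n × ℝ) : join p (Fin.last n) = p.2 := by
  simp [join]

theorem join_castSucc {n : ℕ} (p : Base n × ℝ) (i : Fin n) : join p i.castSucc = p.1 i := by
  simp [join]

theorem height_join {n : ℕ} (p : Base n × ℝ) : height (join p) = p.2 := join_last p

theorem inner_join {n : ℕ} (p q : Base n × ℝ) : ⟪join p, join q⟫ = ⟪p.1, q.1⟫ + p.2 * q.2 := by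
  simp only [PiLp.inner_apply, Fin.sum_univ_castSucc, join_last, join_castSucc]
  simp [mul_comm]

theorem norm_join_sq {n : ℕ} (p : Base n × ℝ) : ‖join p‖ ^ 2 = ‖p.1‖ ^ 2 + p.2 ^ 2 := by
  rw [← real_inner_self_eq_norm_sq, inner_join, real_inner_self_eq_norm_sq]; ring

/-- The horizontal part of a point. -/
noncomputable def horiz {n : ℕ} (x : Space n) : Base n := (join.symm x).1

theorem join_horiz_height {n : ℕ} (x : Space n) : join (horiz x, height x) = x := by
  have h : height x = (join.symm x).2 := by
    conv_lhs => rw [← join.apply_symm_apply x, height_join]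
  rw [h, horiz]
  exact join.apply_symm_apply x

theorem horiz_join {n : ℕ} (p : Base n × ℝ) : horiz (join p) = p.1 := by
  rw [horiz, join.symm_apply_apply]

theorem inner_join_left {n : ℕ} (x : Base n) (z : ℝ) (u : Space n) :
    ⟪join (x, z), u⟫ = ⟪x, horiz u⟫ + z * height u := by
  conv_lhs => rw [← join_horiz_height u, inner_join]

theorem norm_sq_eq_horiz {n : ℕ} (x : Space n) : ‖x‖ ^ 2 = ‖horiz x‖ ^ 2 + height x ^ 2 := by
  conv_lhs => rw [← join_horiz_height x, norm_join_sq]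

theorem continuous_height {n : ℕ} : Continuous (height : Space n → ℝ) := by
  unfold height; fun_prop

theorem continuous_horiz {n : ℕ} : Continuous (horiz : Space n → Base n) := by
  unfold horiz; fun_prop

theorem height_add {n : ℕ} (x y : Space n) : height (x + y) = height x + height y := rfl

theorem height_smul {n : ℕ} (c : ℝ) (x : Space n) : height (c • x) = c * height x := rfl

theorem height_sub {n : ℕ} (x y : Space n) : height (x - y) = height x - height y := rfl

theorem abs_height_le {n : ℕ} (x : Space n) : |height x| ≤ ‖x‖ := by
  have := norm_sq_eq_horiz x
  apply abs_le_of_sq_le_sq _ (norm_nonneg x)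
  nlinarith [sq_nonneg ‖horiz x‖]

theorem norm_horiz_le {n : ℕ} (x : Space n) : ‖horiz x‖ ≤ ‖x‖ := by
  have := norm_sq_eq_horiz x
  apply le_of_sq_le_sq _ (norm_nonneg x)
  nlinarith [sq_nonneg (height x)]

theorem measurePreserving_join {n : ℕ} :
    MeasurePreserving (join : Base n × ℝ → Space n) volume volume := by
  have h1 : MeasurePreserving (fun p : Base n × ℝ => ((p.2, WithLp.ofLp p.1) : ℝ × (Fin n → ℝ)))
      volume volume :=
    (Measure.measurePreserving_swap (μ := (volume : Measure (Fin n → ℝ)))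
      (ν := (volume : Measure ℝ))).comp
      ((PiLp.volume_preserving_ofLp (Fin n)).prod (MeasurePreserving.id volume))
  have h2 := (volume_preserving_piFinSuccAbove (fun _ : Fin (n + 1) => ℝ) (Fin.last n)).symm
  have h3 := (PiLp.volume_preserving_toLp (Fin (n + 1))).comp (h2.comp h1)
  convert! h3 using 1
  ext p i
  refine Fin.lastCases ?_ (fun j => ?_) i
  · simp [join_last, MeasurableEquiv.piFinSuccAbove, Fin.insertNthEquiv]
  · simp [join_castSucc, MeasurableEquiv.piFinSuccAbove, Fin.insertNthEquiv]

end Coconvex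

/-! ### Tangent cones at density points, and comparison of Hausdorff measures. -/

open Metric Set in
open scoped Pointwise in
/-- At almost every point of a set, every direction is tangent to the set. -/
theorem ae_restrict_posTangentConeAt_eq_univ {E : Type*} [NormedAddCommGroup E] [NormedSpace ℝ E]
    [FiniteDimensional ℝ E] [MeasurableSpace E] [BorelSpace E] (μ : Measure E)
    [μ.IsAddHaarMeasure] (s : Set E) :
    ∀ᵐ x ∂μ.restrict s, posTangentConeAt s x = univ := by
  filter_upwards [Besicovitch.ae_tendsto_measure_inter_div μ s] with x hx
  refine eq_univ_of_forall fun z => ?_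
  have key : ∀ k : ℕ, ∃ r : ℝ, ∃ a : E, 0 < r ∧ r < 1 / ((k : ℝ) + 1) ∧
      dist a z ≤ 1 / ((k : ℝ) + 1) ∧ x + r • a ∈ s := by
    intro k
    have hk : 0 < 1 / ((k : ℝ) + 1) := by positivity
    -- Density one at x makes s meet the rescaled ball x + r · B(z, 1/(k+1)) for all small r.
    have B : ∀ᶠ r in 𝓝[>] (0 : ℝ), (s ∩ ({x} + r • closedBall z (1 / ((k : ℝ) + 1)))).Nonempty :=
      Measure.eventually_nonempty_inter_smul_of_density_one μ s x hx _ measurableSet_closedBall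
        (measure_closedBall_pos μ z hk).ne'
    obtain ⟨r, ⟨y, ys, hy⟩, hr⟩ := (B.and (Ioo_mem_nhdsGT hk)).exists
    simp only [mem_smul_set, image_add_left, mem_preimage, singleton_add] at hy
    obtain ⟨a, az, ha⟩ := hy
    refine ⟨r, a, hr.1, hr.2, az, ?_⟩
    rwa [ha, add_neg_cancel_left]
  choose r a hr hr' ha hs using key
  have h0 := tendsto_one_div_add_atTop_nhds_zero_nat (𝕜 := ℝ)
  have hr0 : Tendsto r atTop (𝓝 0) :=
    tendsto_of_tendsto_of_tendsto_of_le_of_le tendsto_const_nhds h0 (fun k => (hr k).le)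
      (fun k => (hr' k).le)
  have haz : Tendsto a atTop (𝓝 z) := by
    rw [tendsto_iff_dist_tendsto_zero]
    exact tendsto_of_tendsto_of_tendsto_of_le_of_le tendsto_const_nhds h0
      (fun k => dist_nonneg) ha
  refine mem_tangentConeAt_of_seq atTop (fun k => (NNReal.mk (r k)⁻¹ (inv_nonneg.2 (hr k).le)))
    (fun k => r k • a k) ?_
    (Eventually.of_forall hs) ?_
  · simpa using hr0.smul haz
  · refine haz.congr fun k => ?_
    rw [NNReal.smul_def, NNReal.coe_mk, smul_smul, inv_mul_cancel₀ (hr k).ne', one_smul]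

/-- If `f` is approximated on `s` by the linear map `A` up to `δ`, then its derivative is `δ`-close
to `A` at the points of `s` where every direction is tangent to `s`. -/
theorem ApproximatesLinearOn.norm_sub_le_of_posTangentConeAt {E F : Type*} [NormedAddCommGroup E]
    [NormedSpace ℝ E] [NormedAddCommGroup F] [NormedSpace ℝ F] {f : E → F} {A f' : E →L[ℝ] F}
    {s : Set E} {δ : NNReal} (hf : ApproximatesLinearOn f A s δ) {x : E} (hx : x ∈ s)
    (hf' : HasFDerivWithinAt f f' s x) (ht : posTangentConeAt s x = Set.univ) :
    ‖f' - A‖ ≤ δ := by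
  refine ContinuousLinearMap.opNorm_le_bound _ δ.2 fun z => ?_
  have hz' : z ∈ posTangentConeAt s x := by rw [ht]; exact Set.mem_univ z
  have hz : z ∈ tangentConeAt ℝ s x := tangentConeAt_mono_field hz'
  obtain ⟨c, d, hd0, hds, hcd⟩ := mem_tangentConeAt_iff_exists_seq.1 hz
  have h1 := hf'.lim hd0 hds hcd
  have h2 : Tendsto (fun k => A (c k • d k)) atTop (𝓝 (A z)) := (A.continuous.tendsto z).comp hcd
  have h3 := (h1.sub h2).norm
  have h4 : Tendsto (fun k => (δ : ℝ) * ‖c k • d k‖) atTop (𝓝 (δ * ‖z‖)) := hcd.norm.const_mul _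
  refine le_of_tendsto_of_tendsto h3 h4 ?_
  filter_upwards [hds] with k hk
  have h5 := hf _ hk _ hx
  rw [add_sub_cancel_left] at h5
  rw [map_smul, ← smul_sub, norm_smul, norm_smul]
  calc ‖c k‖ * ‖f (x + d k) - f x - A (d k)‖ ≤ ‖c k‖ * (δ * ‖d k‖) := by gcongr
    _ = δ * (‖c k‖ * ‖d k‖) := by ring

open scoped ENNReal NNReal in
/-- Comparison of the Hausdorff measures of two images of a set. -/
theorem euclideanHausdorffMeasure_image_le_of_dist_le {X Y Z : Type*} [MetricSpace Y]
    [MeasurableSpace Y] [BorelSpace Y] [MetricSpace Z] [MeasurableSpace Z] [BorelSpace Z]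
    {s : Set X} {f : X → Y} {g : X → Z} {c : ℝ≥0} (n : ℕ)
    (h : ∀ x ∈ s, ∀ y ∈ s, dist (f x) (f y) ≤ c * dist (g x) (g y)) :
    (μHE[n] : Measure Y) (f '' s) ≤ (c : ℝ≥0∞) ^ n * (μHE[n] : Measure Z) (g '' s) := by
  rcases s.eq_empty_or_nonempty with rfl | ⟨x₀, hx₀⟩
  · simp
  have : Nonempty X := ⟨x₀⟩
  -- The distance bound makes f constant on the fibres of g in s, so f factors through g by a
  -- c-Lipschitz map.
  have hinv : ∀ x ∈ s, f (Function.invFunOn g s (g x)) = f x := by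
    intro x hx
    have hex : ∃ a ∈ s, g a = g x := ⟨x, hx, rfl⟩
    have h1 := h _ (Function.invFunOn_mem hex) x hx
    rw [Function.invFunOn_eq hex, dist_self, mul_zero] at h1
    exact dist_le_zero.1 h1
  have himg : f '' s = (f ∘ Function.invFunOn g s) '' (g '' s) := by
    rw [Set.image_image]
    exact Set.image_congr fun x hx => (hinv x hx).symm
  have hL : LipschitzOnWith c (f ∘ Function.invFunOn g s) (g '' s) := by
    refine LipschitzOnWith.of_dist_le_mul ?_
    rintro _ ⟨x, hx, rfl⟩ _ ⟨y, hy, rfl⟩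
    simp only [Function.comp_apply]
    rw [hinv x hx, hinv y hy]
    exact h x hx y hy
  have h2 := hL.hausdorffMeasure_image_le (d := n) (Nat.cast_nonneg n)
  rw [himg]
  simp only [Measure.euclideanHausdorffMeasure_def, Measure.smul_apply, ENNReal.smul_def,
    smul_eq_mul]
  rw [ENNReal.rpow_natCast] at h2
  calc _ ≤ _ := mul_le_mul_right h2 _
    _ = _ := by ring

namespace Coconvex

open scoped ENNReal NNReal

/-! ### The area formula for Lipschitz graphs. -/

/-- The parametrisation of the graph of `G`. -/
noncomputable def graphMap {n : ℕ} (G : Base n → ℝ) (x : Base n) : Space n := join (x, G x)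

/-- The linear map whose image is the graph of the linear form `p`. -/
noncomputable def graphLin {n : ℕ} (p : Base n →L[ℝ] ℝ) : Base n →L[ℝ] Space n :=
  (join : (Base n × ℝ) ≃L[ℝ] Space n).toContinuousLinearMap ∘L
    (ContinuousLinearMap.id ℝ (Base n)).prod p

theorem graphLin_apply {n : ℕ} (p : Base n →L[ℝ] ℝ) (x : Base n) :
    graphLin p x = join (x, p x) := rfl

/-- The area density of a graph whose slope is `p`. -/
noncomputable def graphDensity {n : ℕ} (p : Base n →L[ℝ] ℝ) : ℝ := √(1 + ‖p‖ ^ 2)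

theorem one_le_graphDensity {n : ℕ} (p : Base n →L[ℝ] ℝ) : 1 ≤ graphDensity p := by
  unfold graphDensity
  rw [Real.one_le_sqrt]
  nlinarith [sq_nonneg ‖p‖]

/-- The function t ↦ √(1 + t²) is 1-Lipschitz. -/
theorem graphDensity_le_add {n : ℕ} (p q : Base n →L[ℝ] ℝ) :
    graphDensity p ≤ graphDensity q + ‖p - q‖ := by
  have h1 := one_le_graphDensity q
  have hp : ‖p‖ ≤ ‖q‖ + ‖p - q‖ := by
    calc ‖p‖ = ‖q + (p - q)‖ := by rw [add_sub_cancel]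
      _ ≤ _ := norm_add_le _ _
  have hq : graphDensity q ^ 2 = 1 + ‖q‖ ^ 2 := Real.sq_sqrt (by positivity)
  have hq' : ‖q‖ ≤ graphDensity q := Real.le_sqrt_of_sq_le (by linarith)
  have h0 := norm_nonneg (p - q)
  refine Real.sqrt_le_iff.2 ⟨by linarith, ?_⟩
  nlinarith [norm_nonneg p, norm_nonneg q, mul_le_mul_of_nonneg_right hq' h0]

theorem norm_le_norm_graphLin {n : ℕ} (p : Base n →L[ℝ] ℝ) (x : Base n) :
    ‖x‖ ≤ ‖graphLin p x‖ := by
  have := norm_horiz_le (graphLin p x)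
  rwa [graphLin_apply, horiz_join] at this

/-- In an orthonormal basis the Gram matrix of the graph map is the identity plus the rank-one
matrix vvᵀ, whose determinant is 1 + |v|². -/
theorem normDet_graphLin {n : ℕ} (p : Base n →L[ℝ] ℝ) :
    (graphLin p : Base n →ₗ[ℝ] Space n).normDet = graphDensity p := by
  have hp : ‖p‖ ^ 2 = ∑ i, p (EuclideanSpace.basisFun (Fin n) ℝ i) ^ 2 := by
    obtain ⟨w, rfl⟩ := (InnerProductSpace.toDual ℝ (Base n)).surjective p
    rw [LinearIsometryEquiv.norm_map, EuclideanSpace.norm_sq_eq]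
    refine Finset.sum_congr rfl fun i _ => ?_
    simp [EuclideanSpace.inner_single_right]
  have hsq := (graphLin p : Base n →ₗ[ℝ] Space n).normDet_sq_eq_det_gram
    (EuclideanSpace.basisFun (Fin n) ℝ)
  set v : Fin n → ℝ := fun i => p (EuclideanSpace.basisFun (Fin n) ℝ i) with hv
  have hgram : Matrix.gram ℝ (fun i => (graphLin p : Base n →ₗ[ℝ] Space n)
      (EuclideanSpace.basisFun (Fin n) ℝ i)) =
      1 + Matrix.replicateCol (Fin 1) v * Matrix.replicateRow (Fin 1) v := by
    ext i j
    have ho := orthonormal_iff_ite.1 (EuclideanSpace.basisFun (Fin n) ℝ).orthonormal i j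
    rw [Matrix.gram_apply, ContinuousLinearMap.coe_coe, graphLin_apply, graphLin_apply, inner_join,
      Matrix.add_apply, Matrix.one_apply, ho, Matrix.mul_apply]
    simp [hv]
  have hdet : (1 + Matrix.replicateCol (Fin 1) v * Matrix.replicateRow (Fin 1) v).det =
      1 + v ⬝ᵥ v := by
    convert Matrix.det_one_add_replicateCol_mul_replicateRow (ι := Fin 1) v v <;> rfl
  rw [hgram, hdet] at hsq
  have h2 : (graphLin p : Base n →ₗ[ℝ] Space n).normDet ^ 2 = 1 + ‖p‖ ^ 2 := by
    rw [hp]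
    simpa [dotProduct, pow_two, hv] using hsq
  rw [graphDensity, ← h2, Real.sqrt_sq (LinearMap.normDet_nonneg _)]

theorem euclideanHausdorffMeasure_graphLin_image {n : ℕ} (p : Base n →L[ℝ] ℝ) (s : Set (Base n)) :
    (μHE[n] : Measure (Space n)) (graphLin p '' s) =
      ENNReal.ofReal (graphDensity p) * volume s := by
  have h := (graphLin p : Base n →ₗ[ℝ] Space n).euclideanHausdorffMeasure_image_eq_normDet_mul_volume s
  rw [finrank_euclideanSpace_fin, normDet_graphLin] at h
  exact h

theorem continuous_graphMap {n : ℕ} {G : Base n → ℝ} (hG : Continuous G) :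
    Continuous (graphMap G) := by
  unfold graphMap; fun_prop

theorem horiz_graphMap {n : ℕ} (G : Base n → ℝ) (x : Base n) : horiz (graphMap G x) = x :=
  horiz_join _

theorem injective_graphMap {n : ℕ} (G : Base n → ℝ) : Function.Injective (graphMap G) :=
  Function.LeftInverse.injective (horiz_graphMap G)

theorem measurableEmbedding_graphMap {n : ℕ} {G : Base n → ℝ} (hG : Continuous G) :
    MeasurableEmbedding (graphMap G) :=
  (continuous_graphMap hG).measurableEmbedding (injective_graphMap G)

theorem norm_join_zero {n : ℕ} (t : ℝ) : ‖(join (0, t) : Space n)‖ = |t| := by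
  have h := norm_join_sq ((0, t) : Base n × ℝ)
  simp only [norm_zero] at h
  rw [← sq_eq_sq₀ (norm_nonneg _) (abs_nonneg t), h, sq_abs]; ring

/-- The horizontal parts cancel, so the linearisation error of the graph is the error of the
function itself. -/
theorem norm_graphMap_sub_sub {n : ℕ} (G : Base n → ℝ) (p : Base n →L[ℝ] ℝ) (x y : Base n) :
    ‖graphMap G x - graphMap G y - graphLin p (x - y)‖ = |G x - G y - p (x - y)| := by
  rw [graphMap, graphMap, graphLin_apply, ← map_sub, ← map_sub, ← norm_join_zero (n := n)]
  congr 2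
  ext <;> simp

/-- The area of a piece of a graph on which the function is approximated by a linear form. -/
theorem euclideanHausdorffMeasure_graphMap_comparison {n : ℕ} {G : Base n → ℝ}
    {p : Base n →L[ℝ] ℝ} {s : Set (Base n)} {c δ : ℝ≥0} (hδ : 1 + δ ≤ c) (hδ' : 1 + c * δ ≤ c)
    (hs : ApproximatesLinearOn G p s δ) :
    (μHE[n] : Measure (Space n)) (graphMap G '' s) ≤
        (c : ℝ≥0∞) ^ n * (ENNReal.ofReal (graphDensity p) * volume s) ∧
      ENNReal.ofReal (graphDensity p) * volume s ≤
        (c : ℝ≥0∞) ^ n * (μHE[n] : Measure (Space n)) (graphMap G '' s) := by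
  rw [← euclideanHausdorffMeasure_graphLin_image]
  have h1 : (1 : ℝ) + δ ≤ c := by exact_mod_cast hδ
  have h2 : (1 : ℝ) + c * δ ≤ c := by exact_mod_cast hδ'
  -- Neither graph map shortens distances in the base, so the additive error δ‖x - y‖ is absorbed
  -- into the factor c in both directions.
  have main : ∀ x ∈ s, ∀ y ∈ s,
      ‖graphMap G x - graphMap G y - graphLin p (x - y)‖ ≤ δ * ‖x - y‖ := by
    intro x hx y hy
    rw [norm_graphMap_sub_sub]
    exact hs x hx y hy
  constructor
  · refine euclideanHausdorffMeasure_image_le_of_dist_le n fun x hx y hy => ?_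
    rw [dist_eq_norm, dist_eq_norm, ← map_sub]
    have h3 := main x hx y hy
    have h4 := norm_le_norm_graphLin p (x - y)
    have h5 : ‖graphMap G x - graphMap G y‖ ≤ ‖graphLin p (x - y)‖ + δ * ‖x - y‖ := by
      have := norm_sub_norm_le (graphMap G x - graphMap G y) (graphLin p (x - y))
      linarith
    nlinarith [δ.2, norm_nonneg (graphLin p (x - y)), mul_le_mul_of_nonneg_left h4 δ.2]
  · refine euclideanHausdorffMeasure_image_le_of_dist_le n fun x hx y hy => ?_
    rw [dist_eq_norm, dist_eq_norm, ← map_sub]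
    have h3 := main x hx y hy
    have h4 := norm_le_norm_graphLin p (x - y)
    have h4' : ‖x - y‖ ≤ ‖graphMap G x - graphMap G y‖ := by
      have := norm_horiz_le (graphMap G x - graphMap G y)
      rw [graphMap, graphMap, ← map_sub, horiz_join] at this
      rw [graphMap, graphMap, ← map_sub]
      exact this
    have h5 : ‖graphLin p (x - y)‖ ≤ ‖graphMap G x - graphMap G y‖ + δ * ‖x - y‖ := by
      have := norm_sub_norm_le (graphLin p (x - y)) (graphMap G x - graphMap G y)
      rw [norm_sub_rev (graphLin p (x - y))] at this
      linarith
    nlinarith [δ.2, mul_le_mul_of_nonneg_left h4' δ.2, norm_nonneg (graphMap G x - graphMap G y)]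

theorem graphDensity_le_mul {n : ℕ} {p q : Base n →L[ℝ] ℝ} {c δ : ℝ≥0} (hδ : 1 + δ ≤ c)
    (h : ‖p - q‖ ≤ δ) :
    ENNReal.ofReal (graphDensity p) ≤ c * ENNReal.ofReal (graphDensity q) := by
  have h1 : (1 : ℝ) + δ ≤ c := by exact_mod_cast hδ
  rw [← ENNReal.ofReal_coe_nnreal, ← ENNReal.ofReal_mul c.coe_nonneg]
  apply ENNReal.ofReal_le_ofReal
  have := graphDensity_le_add p q
  nlinarith [one_le_graphDensity q, δ.2]

/-- Almost every point of s has full tangent cone, so the derivative there is δ-close to p and the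
density is nearly constant. This costs one factor c beyond the cⁿ of the image comparison. -/
theorem lintegral_graphDensity_comparison {n : ℕ} {G : Base n → ℝ} {c δ : ℝ≥0} (hδ : 1 + δ ≤ c)
    (hδ' : 1 + c * δ ≤ c) {s : Set (Base n)} (hs : MeasurableSet s) {p : Base n →L[ℝ] ℝ}
    (hd : ∀ x ∈ s, DifferentiableAt ℝ G x) (hp : ApproximatesLinearOn G p s δ) :
    (μHE[n] : Measure (Space n)) (graphMap G '' s) ≤
        (c : ℝ≥0∞) ^ (n + 1) * ∫⁻ x in s, ENNReal.ofReal (graphDensity (fderiv ℝ G x)) ∧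
      ∫⁻ x in s, ENNReal.ofReal (graphDensity (fderiv ℝ G x)) ≤
        (c : ℝ≥0∞) ^ (n + 1) * (μHE[n] : Measure (Space n)) (graphMap G '' s) := by
  have hae : ∀ᵐ x ∂volume.restrict s, ‖fderiv ℝ G x - p‖ ≤ δ := by
    filter_upwards [ae_restrict_posTangentConeAt_eq_univ volume s, ae_restrict_mem hs] with x hx hxs
    exact hp.norm_sub_le_of_posTangentConeAt hxs (hd x hxs).hasFDerivAt.hasFDerivWithinAt hx
  obtain ⟨h1, h2⟩ := euclideanHausdorffMeasure_graphMap_comparison hδ hδ' hp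
  have hconst : ENNReal.ofReal (graphDensity p) * volume s =
      ∫⁻ _ in s, ENNReal.ofReal (graphDensity p) := by
    rw [lintegral_const, Measure.restrict_apply_univ]
  constructor
  · refine h1.trans ?_
    rw [pow_succ, mul_assoc]
    refine mul_le_mul_right ?_ _
    rw [hconst, ← lintegral_const_mul' _ _ ENNReal.coe_ne_top]
    refine lintegral_mono_ae ?_
    filter_upwards [hae] with x hx
    exact graphDensity_le_mul hδ (by rwa [norm_sub_rev])
  · calc ∫⁻ x in s, ENNReal.ofReal (graphDensity (fderiv ℝ G x))
        ≤ ∫⁻ x in s, c * ENNReal.ofReal (graphDensity p) := by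
          refine lintegral_mono_ae ?_
          filter_upwards [hae] with x hx
          exact graphDensity_le_mul hδ hx
      _ = c * (ENNReal.ofReal (graphDensity p) * volume s) := by
          rw [lintegral_const_mul' _ _ ENNReal.coe_ne_top, hconst]
      _ ≤ c * ((c : ℝ≥0∞) ^ n * (μHE[n] : Measure (Space n)) (graphMap G '' s)) := by gcongr
      _ = _ := by rw [pow_succ]; ring

theorem measurable_graphDensity_fderiv {n : ℕ} (G : Base n → ℝ) :
    Measurable fun x => graphDensity (fderiv ℝ G x) := by
  have h := measurable_fderiv ℝ G
  unfold graphDensity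
  exact ((h.norm.pow_const 2).const_add 1).sqrt

theorem le_of_forall_nnreal_pow_mul {a b : ℝ≥0∞} (m : ℕ)
    (h : ∀ c : ℝ≥0, 1 < c → a ≤ (c : ℝ≥0∞) ^ m * b) : a ≤ b := by
  have ht : Tendsto (fun k : ℕ => ((1 + 1 / ((k : ℝ≥0) + 1) : ℝ≥0) : ℝ≥0∞) ^ m * b) atTop
      (𝓝 (1 * b)) := by
    refine ENNReal.Tendsto.mul_const ?_ (Or.inl one_ne_zero)
    have h0 : Tendsto (fun k : ℕ => (1 + 1 / ((k : ℝ≥0) + 1) : ℝ≥0) ^ m) atTop (𝓝 ((1 + 0) ^ m)) :=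
      ((tendsto_one_div_add_atTop_nhds_zero_nat (𝕜 := ℝ≥0)).const_add 1).pow m
    have h1 := ENNReal.tendsto_coe.2 h0
    simpa using h1
  rw [one_mul] at ht
  refine ge_of_tendsto' ht fun k => h _ ?_
  have : (0 : ℝ≥0) < 1 / ((k : ℝ≥0) + 1) := by positivity
  exact lt_add_of_pos_right 1 this

/-- The area formula for Lipschitz graphs. -/
theorem comap_graphMap_euclideanHausdorffMeasure {n : ℕ} {G : Base n → ℝ} {C : ℝ≥0}
    (hG : LipschitzWith C G) :
    (μHE[n] : Measure (Space n)).comap (graphMap G) =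
      volume.withDensity fun x => ENNReal.ofReal (graphDensity (fderiv ℝ G x)) := by
  have hemb := measurableEmbedding_graphMap hG.continuous
  set ν := (μHE[n] : Measure (Space n)).comap (graphMap G) with hν
  set μ' := (volume : Measure (Base n)).withDensity
    fun x => ENNReal.ofReal (graphDensity (fderiv ℝ G x)) with hμ'
  set Z : Set (Base n) := {x | DifferentiableAt ℝ G x} with hZ
  have hZm : MeasurableSet Z := measurableSet_of_differentiableAt ℝ G
  have hZ0 : volume Zᶜ = 0 := hG.ae_differentiableAt
  -- The graph map is (1 + C)-Lipschitz, so it carries the Rademacher null set to a null set.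
  have hνZ : ν Zᶜ = 0 := by
    rw [hν, hemb.comap_apply]
    have hle := euclideanHausdorffMeasure_image_le_of_dist_le (s := Zᶜ) (f := graphMap G)
      (g := (id : Base n → Base n)) (c := 1 + C) n (fun x _ y _ => by
        have h1 := norm_graphMap_sub_sub G 0 x y
        have h2 : ‖graphLin (0 : Base n →L[ℝ] ℝ) (x - y)‖ = ‖x - y‖ := by
          have := norm_join_sq ((x - y, 0) : Base n × ℝ)
          rw [graphLin_apply, ← sq_eq_sq₀ (norm_nonneg _) (norm_nonneg _)]
          simpa using this
        have h3 : |G x - G y| ≤ C * ‖x - y‖ := by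
          have := hG.dist_le_mul x y
          rwa [Real.dist_eq, dist_eq_norm] at this
        have h4 := norm_sub_norm_le (graphMap G x - graphMap G y)
          (graphLin (0 : Base n →L[ℝ] ℝ) (x - y))
        rw [dist_eq_norm, id, id, dist_eq_norm]
        push_cast
        rw [h1, h2] at h4
        simp only [zero_apply, sub_zero] at h4
        linarith)
    rw [Set.image_id, EuclideanSpace.euclideanHausdorffMeasure_eq_volume, hZ0, mul_zero] at hle
    exact le_antisymm hle bot_le
  have hμZ : μ' Zᶜ = 0 := withDensity_absolutelyContinuous _ _ hZ0
  have key : ∀ c : ℝ≥0, 1 < c → ∀ s, MeasurableSet s → s ⊆ Z →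
      ν s ≤ (c : ℝ≥0∞) ^ (n + 1) * μ' s ∧ μ' s ≤ (c : ℝ≥0∞) ^ (n + 1) * ν s := by
    intro c hc s hs hsZ
    have hc0 : (0 : ℝ≥0) < c := zero_lt_one.trans hc
    -- This δ solves 1 + cδ = c; as c > 1, it also satisfies 1 + δ ≤ c.
    set δ : ℝ≥0 := (c - 1) / c with hδ
    have hcδ : c * δ = c - 1 := by rw [hδ]; field_simp
    have hδ2 : 1 + c * δ ≤ c := by rw [hcδ, add_tsub_cancel_of_le hc.le]
    have hδ1 : 1 + δ ≤ c := by
      refine le_trans ?_ hδ2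
      gcongr
      exact le_mul_of_one_le_left bot_le hc.le
    have hδ0 : δ ≠ 0 := by
      rw [hδ]; exact div_ne_zero (tsub_pos_of_lt hc).ne' hc0.ne'
    obtain ⟨t, p, hdisj, htm, hst, happ, -⟩ :=
      exists_partition_approximatesLinearOn_of_hasFDerivWithinAt G s (fderiv ℝ G)
        (fun x hx => (hsZ hx).hasFDerivAt.hasFDerivWithinAt) (fun _ => δ) (fun _ => hδ0)
    have hsum : ∀ m : Measure (Base n), m s = ∑' k, m (s ∩ t k) := by
      intro m
      rw [← measure_iUnion (fun i j hij => (hdisj hij).mono Set.inter_subset_right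
        Set.inter_subset_right) (fun k => hs.inter (htm k)), ← Set.inter_iUnion,
        Set.inter_eq_left.2 hst]
    have hpiece : ∀ k, ν (s ∩ t k) ≤ (c : ℝ≥0∞) ^ (n + 1) * μ' (s ∩ t k) ∧
        μ' (s ∩ t k) ≤ (c : ℝ≥0∞) ^ (n + 1) * ν (s ∩ t k) := by
      intro k
      rw [hν, hemb.comap_apply, hμ', withDensity_apply _ (hs.inter (htm k))]
      exact lintegral_graphDensity_comparison hδ1 hδ2 (hs.inter (htm k))
        (fun x hx => hsZ hx.1) (happ k)
    constructor
    · rw [hsum ν, hsum μ', ← ENNReal.tsum_mul_left]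
      exact ENNReal.tsum_le_tsum fun k => (hpiece k).1
    · rw [hsum ν, hsum μ', ← ENNReal.tsum_mul_left]
      exact ENNReal.tsum_le_tsum fun k => (hpiece k).2
  refine Measure.ext fun s hs => ?_
  have e1 : ∀ m : Measure (Base n), m Zᶜ = 0 → m s = m (s ∩ Z) := by
    intro m hm
    exact (measure_inter_conull hm).symm
  rw [e1 ν hνZ, e1 μ' hμZ]
  refine le_antisymm ?_ ?_
  · exact le_of_forall_nnreal_pow_mul (n + 1) fun c hc =>
      (key c hc _ (hs.inter hZm) Set.inter_subset_right).1
  · exact le_of_forall_nnreal_pow_mul (n + 1) fun c hc =>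
      (key c hc _ (hs.inter hZm) Set.inter_subset_right).2

/-! ### Unit normals of convex sets. -/

theorem IsUnitNormal.inner_le_of_mem_closure {n : ℕ} {K : Set (Space n)} {x u z : Space n}
    (h : IsUnitNormal K x u) (hz : z ∈ closure K) : ⟪z, u⟫ ≤ ⟪x, u⟫ := by
  have hc : IsClosed {y : Space n | ⟪y, u⟫ ≤ ⟪x, u⟫} := isClosed_le (by fun_prop) (by fun_prop)
  exact closure_minimal (fun y hy => h.2 y hy) hc hz

theorem IsUnitNormal.inner_lt_of_mem_interior {n : ℕ} {K : Set (Space n)} {x u p : Space n}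
    (h : IsUnitNormal K x u) (hp : p ∈ interior K) : ⟪p, u⟫ < ⟪x, u⟫ := by
  have ht : Tendsto (fun ε : ℝ => p + ε • u) (𝓝[>] 0) (𝓝 p) := by
    have : Tendsto (fun ε : ℝ => p + ε • u) (𝓝 0) (𝓝 (p + (0 : ℝ) • u)) :=
      Continuous.tendsto (by fun_prop) 0
    rw [zero_smul, add_zero] at this
    exact this.mono_left nhdsWithin_le_nhds
  obtain ⟨ε, hε, hε0⟩ := ((ht.eventually (mem_interior_iff_mem_nhds.1 hp)).and
    self_mem_nhdsWithin).exists
  have h1 := h.2 _ hε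
  rw [inner_add_left, real_inner_smul_left, real_inner_self_eq_norm_sq, h.1] at h1
  have : (0 : ℝ) < ε := hε0
  linarith

/-- Hahn–Banach separates w from the open convex interior, and the inequality passes to K because K
lies in the closure of its interior. -/
theorem exists_isUnitNormal_of_notMem_interior {n : ℕ} {K : Set (Space n)} (hK : Convex ℝ K)
    (hne : (interior K).Nonempty) {w : Space n} (hw : w ∉ interior K) :
    ∃ u, IsUnitNormal K w u := by
  obtain ⟨f, hf⟩ := geometric_hahn_banach_open_point hK.interior isOpen_interior hw
  set v := (InnerProductSpace.toDual ℝ (Space n)).symm f with hv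
  have hfv : ∀ z, f z = ⟪z, v⟫ := fun z => by
    rw [real_inner_comm, hv, InnerProductSpace.toDual_symm_apply]
  obtain ⟨p, hp⟩ := hne
  have hv0 : v ≠ 0 := by
    intro h0
    have := hf p hp
    rw [hfv, hfv, h0, inner_zero_right, inner_zero_right] at this
    exact lt_irrefl _ this
  have hvn : 0 < ‖v‖ := norm_pos_iff.2 hv0
  refine ⟨‖v‖⁻¹ • v, ?_, fun z hz => ?_⟩
  · rw [norm_smul, norm_inv, norm_norm, inv_mul_cancel₀ hvn.ne']
  · rw [real_inner_smul_right, real_inner_smul_right]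
    refine mul_le_mul_of_nonneg_left ?_ (inv_nonneg.2 hvn.le)
    have hcl : z ∈ closure (interior K) := by
      rw [hK.closure_interior_eq_closure_of_nonempty_interior ⟨p, hp⟩]
      exact subset_closure hz
    have hc : IsClosed {y : Space n | ⟪y, v⟫ ≤ ⟪w, v⟫} := isClosed_le (by fun_prop) (by fun_prop)
    refine closure_minimal (fun y hy => ?_) hc hcl
    have := hf y hy
    rw [hfv, hfv] at this
    exact this.le

/-- Between an interior point and a point outside the closure of a convex set there is a boundary
point. -/
theorem exists_frontier_between {n : ℕ} {K : Set (Space n)} {p z : Space n}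
    (hp : p ∈ interior K) (hz : z ∉ closure K) :
    ∃ c : ℝ, 0 < c ∧ c < 1 ∧ p + c • (z - p) ∈ frontier K := by
  have hpre : IsPreconnected (segment ℝ p z) := (convex_segment p z).isPreconnected
  obtain ⟨w, hw, hwf⟩ : ∃ w ∈ segment ℝ p z, w ∈ frontier K := by
    by_contra! hno
    obtain ⟨w, -, hw1, hw2⟩ := hpre (interior K) (closure K)ᶜ isOpen_interior
      isClosed_closure.isOpen_compl
      (fun w hw => by
        by_cases h : w ∈ closure K
        · exact Or.inl (by_contra fun h' => hno w hw ⟨h, h'⟩)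
        · exact Or.inr h)
      ⟨p, left_mem_segment ℝ p z, hp⟩ ⟨z, right_mem_segment ℝ p z, hz⟩
    exact hw2 (interior_subset_closure hw1)
  rw [segment_eq_image'] at hw
  obtain ⟨c, ⟨hc0, hc1⟩, rfl⟩ := hw
  refine ⟨c, lt_of_le_of_ne hc0 ?_, lt_of_le_of_ne hc1 ?_, hwf⟩
  · rintro rfl
    simp only [zero_smul, add_zero] at hwf
    exact hwf.2 hp
  · rintro rfl
    simp only [one_smul, add_sub_cancel] at hwf
    exact hz hwf.1

/-- The product with u increases strictly from the interior point p to the boundary point, hence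
also beyond it along the same line. -/
theorem IsUnitNormal.inner_lt_of_between {n : ℕ} {K : Set (Space n)} {p z u : Space n} {c : ℝ}
    (hp : p ∈ interior K) (hc0 : 0 < c) (hc1 : c < 1) (hu : IsUnitNormal K (p + c • (z - p)) u) :
    ⟪p + c • (z - p), u⟫ < ⟪z, u⟫ := by
  have h := hu.inner_lt_of_mem_interior hp
  simp only [inner_add_left, real_inner_smul_left, inner_sub_left] at h ⊢
  have h1 : 0 < ⟪z, u⟫ - ⟪p, u⟫ := pos_of_mul_pos_right (by linarith) hc0.le
  nlinarith

/-! ### Monotonicity and convexity of the asymptotic boundary sets. -/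

/-- A point of height `t` that lies in all supporting half-spaces at boundary points of height `t`
lies in the closure. -/
theorem mem_closure_of_mem_supporting {n : ℕ} {K : Set (Space n)} (hK : Convex ℝ K) {p z : Space n}
    (hp : p ∈ interior K) (hpz : height p = height z)
    (h : ∀ x ∈ frontier K, height x = height z → ∀ u, IsUnitNormal K x u → ⟪z, u⟫ ≤ ⟪x, u⟫) :
    z ∈ closure K := by
  by_contra hz
  obtain ⟨c, hc0, hc1, hw⟩ := exists_frontier_between hp hz
  obtain ⟨u, hu⟩ := exists_isUnitNormal_of_notMem_interior hK ⟨p, hp⟩ hw.2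
  have h1 := h _ hw (by rw [height_add, height_smul, height_sub, hpz]; ring) u hu
  exact absurd (hu.inner_lt_of_between hp hc0 hc1) (not_lt.2 h1)

/-- Join y ∈ A_t(K) to a boundary point x of height s. The point z of the segment at height t
satisfies all height-t supporting inequalities, so it lies in the closure of K. A normal at x thus
cannot separate z from K, and since z precedes x on the segment it cannot separate y either. -/
theorem asymptoticSetAt_mono {n : ℕ} {K : Set (Space n)} (hK : Convex ℝ K)
    (hint : ∀ t : ℝ, 0 < t → ∃ p ∈ interior K, height p = t) {t s : ℝ} (ht : 0 < t) (hts : t ≤ s) :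
    asymptoticSetAt K t ⊆ asymptoticSetAt K s := by
  rcases hts.eq_or_lt with rfl | hts
  · exact subset_rfl
  rintro y ⟨hy0, hyt, hy⟩
  refine ⟨hy0, hyt.trans hts.le, fun x hx hxs u hu => ?_⟩
  obtain ⟨p, hp, hpt⟩ := hint t ht
  have hd : 0 < s - height y := by linarith
  set c : ℝ := (t - height y) / (s - height y) with hc
  have hc0 : 0 ≤ c := div_nonneg (by linarith) hd.le
  have hc1 : c < 1 := by rw [hc, div_lt_one hd]; linarith
  set z := y + c • (x - y) with hz
  have hzt : height z = t := by
    rw [hz, height_add, height_smul, height_sub, hxs, hc]; field_simp; ring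
  have hzcl : z ∈ closure K := by
    refine mem_closure_of_mem_supporting hK hp (hpt.trans hzt.symm) fun w hw hwz v hv => ?_
    have h1 := hy w hw (hwz.trans hzt) v hv
    have h2 := hv.inner_le_of_mem_closure hx.1
    rw [hz, inner_add_left, real_inner_smul_left, inner_sub_left]
    nlinarith
  have h3 := hu.inner_le_of_mem_closure hzcl
  rw [hz, inner_add_left, real_inner_smul_left, inner_sub_left] at h3
  nlinarith

/-- The interior is convex and has points near 0 below height t and points above height t;
interpolate between them. -/
theorem exists_interior_height {n : ℕ} {K : Set (Space n)} (hK : Convex ℝ K)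
    (hne : (interior K).Nonempty) (h0 : (0 : Space n) ∈ closure K)
    (hunb : ∀ T : ℝ, ∃ x ∈ closure K, T ≤ height x) (t : ℝ) (ht : 0 < t) :
    ∃ p ∈ interior K, height p = t := by
  have hcl := hK.closure_interior_eq_closure_of_nonempty_interior hne
  obtain ⟨x, hx, hxt⟩ := hunb (t + 1)
  rw [← hcl] at h0 hx
  obtain ⟨q, hq, hqi⟩ := mem_closure_iff.1 h0 {y | height y < t}
    (isOpen_lt continuous_height continuous_const) (by simpa [height] using ht)
  obtain ⟨r, hr, hri⟩ := mem_closure_iff.1 hx {y | t < height y}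
    (isOpen_lt continuous_const continuous_height) (by change t < height x; linarith)
  change height q < t at hq
  change t < height r at hr
  have hd : 0 < height r - height q := by linarith
  refine ⟨q + ((t - height q) / (height r - height q)) • (r - q), ?_, ?_⟩
  · refine hK.interior.add_smul_sub_mem hqi hri ⟨div_nonneg (by linarith) hd.le, ?_⟩
    rw [div_le_one hd]; linarith
  · rw [height_add, height_smul, height_sub]; field_simp; ring

theorem height_nonneg_of_mem_asymptoticSet {n : ℕ} {K : Set (Space n)} {x : Space n}
    (hx : x ∈ asymptoticSet K) : 0 ≤ height x := by
  have hc : IsClosed {y : Space n | 0 ≤ height y} := isClosed_le continuous_const continuous_height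
  refine closure_minimal (fun y hy => ?_) hc hx
  simp only [Set.mem_iUnion] at hy
  obtain ⟨t, -, hy⟩ := hy
  exact hy.1

theorem isClosed_asymptoticSet {n : ℕ} (K : Set (Space n)) : IsClosed (asymptoticSet K) :=
  isClosed_closure

theorem asymptoticSetAt_subset_asymptoticSet {n : ℕ} (K : Set (Space n)) {t : ℝ} (ht : 0 < t) :
    asymptoticSetAt K t ⊆ asymptoticSet K := fun _ hx =>
  subset_closure (Set.mem_biUnion (Set.mem_Ioi.2 ht) hx)

theorem convex_asymptoticSetAt {n : ℕ} (K : Set (Space n)) (t : ℝ) :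
    Convex ℝ (asymptoticSetAt K t) := by
  rintro x ⟨hx0, hxt, hx⟩ y ⟨hy0, hyt, hy⟩ a b ha hb hab
  refine ⟨?_, ?_, fun z hz hzt u hu => ?_⟩
  · rw [height_add, height_smul, height_smul]; positivity
  · rw [height_add, height_smul, height_smul]
    calc a * height x + b * height y ≤ a * t + b * t := by gcongr
      _ = t := by rw [← add_mul, hab, one_mul]
  · rw [inner_add_left, real_inner_smul_left, real_inner_smul_left]
    calc a * ⟪x, u⟫ + b * ⟪y, u⟫ ≤ a * ⟪z, u⟫ + b * ⟪z, u⟫ := by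
          gcongr
          · exact hx z hz hzt u hu
          · exact hy z hz hzt u hu
      _ = ⟪z, u⟫ := by rw [← add_mul, hab, one_mul]

/-- By monotonicity in t, any two points of the union lie in a common convex A_t(K). -/
theorem convex_asymptoticSet {n : ℕ} {K : Set (Space n)} (hK : Convex ℝ K)
    (hint : ∀ t : ℝ, 0 < t → ∃ p ∈ interior K, height p = t) : Convex ℝ (asymptoticSet K) := by
  refine Convex.closure ?_
  intro x hx y hy
  simp only [Set.mem_iUnion] at hx hy
  obtain ⟨t, ht, hx⟩ := hx
  obtain ⟨s, hs, hy⟩ := hy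
  intro a b ha hb hab
  have ht' : 0 < max t s := lt_max_of_lt_left ht
  exact Set.mem_biUnion (Set.mem_Ioi.2 ht') (convex_asymptoticSetAt K (max t s)
    (asymptoticSetAt_mono hK hint ht (le_max_left _ _) hx)
    (asymptoticSetAt_mono hK hint hs (le_max_right _ _) hy) ha hb hab)

theorem closure_subset_asymptoticSet {n : ℕ} {K : Set (Space n)} (h : ∀ x ∈ K, 0 ≤ height x) :
    closure K ⊆ asymptoticSet K := by
  refine closure_minimal (fun x hx => ?_) (isClosed_asymptoticSet K)
  have ht : 0 < height x + 1 := by linarith [h x hx]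
  exact asymptoticSetAt_subset_asymptoticSet K ht
    ⟨h x hx, by linarith, fun z _ _ u hu => hu.2 x hx⟩

/-- Without boundary points at height t the condition defining A_t(K) is vacuous, so A_t(K) is a
whole slab and the base is unbounded. A horizontal direction exists since n ≥ 1. -/
theorem MemCc.exists_frontier_height {n : ℕ} (hn : 1 ≤ n) {K : Set (Space n)} (hK : MemCc K)
    {t : ℝ} (ht : 0 < t) : ∃ x ∈ frontier K, height x = t := by
  by_contra! hno
  obtain ⟨R, hR⟩ := hK.compact_base.isBounded.exists_norm_le
  set v : Space n := join (EuclideanSpace.single (⟨0, hn⟩ : Fin n) (|R| + 1), 0) with hv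
  have hv0 : height v = 0 := height_join _
  have hmem : v ∈ asymptoticSet K := by
    refine asymptoticSetAt_subset_asymptoticSet K ht ⟨hv0.ge, hv0.trans_le ht.le, ?_⟩
    intro x hx hxt
    exact absurd hxt (hno x hx)
  have h1 := hR v ⟨hmem, hv0⟩
  have h2 := norm_horiz_le v
  rw [hv, horiz_join, ← hv] at h2
  simp only [PiLp.norm_single, Real.norm_eq_abs] at h2
  have h3 : |(|R| + 1)| = |R| + 1 := abs_of_nonneg (by positivity)
  linarith [le_abs_self R]

theorem MemCc.zero_mem_closure {n : ℕ} {K : Set (Space n)} (hK : MemCc K) :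
    (0 : Space n) ∈ closure K := hK.zero_mem_frontier.1

theorem MemCc.exists_interior_height {n : ℕ} (hn : 1 ≤ n) {K : Set (Space n)} (hK : MemCc K)
    (t : ℝ) (ht : 0 < t) : ∃ p ∈ interior K, height p = t := by
  refine Coconvex.exists_interior_height hK.convex hK.interior_nonempty hK.zero_mem_closure
    (fun T => ?_) t ht
  obtain ⟨x, hx, hxt⟩ := hK.exists_frontier_height hn (t := max T 1) (by positivity)
  exact ⟨x, hx.1, hxt ▸ le_max_left _ _⟩

theorem MemCc.convex_asymptoticSet {n : ℕ} (hn : 1 ≤ n) {K : Set (Space n)} (hK : MemCc K) :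
    Convex ℝ (asymptoticSet K) :=
  Coconvex.convex_asymptoticSet hK.convex (hK.exists_interior_height hn)

theorem MemCc.closure_subset {n : ℕ} {K : Set (Space n)} (hK : MemCc K) :
    closure K ⊆ asymptoticSet K := closure_subset_asymptoticSet hK.height_nonneg

theorem MemCc.zero_mem {n : ℕ} {K : Set (Space n)} (hK : MemCc K) :
    (0 : Space n) ∈ asymptoticSet K := hK.closure_subset hK.zero_mem_closure

/-! ### Recession directions and stability of A(K). -/

/-- `θ` is a recession direction of `A`. -/
def IsRecession {n : ℕ} (A : Set (Space n)) (θ : Space n) : Prop :=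
  ∀ x ∈ A, ∀ s : ℝ, 0 ≤ s → x + s • θ ∈ A

/-- By convexity y + (s/‖x_k‖)(x_k - y) lies in A for large k, and it tends to y + sθ. -/
theorem isRecession_of_tendsto {n : ℕ} {A : Set (Space n)} (hA : IsClosed A) (hc : Convex ℝ A)
    {x : ℕ → Space n} (hx : ∀ k, x k ∈ A) (hinf : Tendsto (fun k => ‖x k‖) atTop atTop)
    {θ : Space n} (hθ : Tendsto (fun k => ‖x k‖⁻¹ • x k) atTop (𝓝 θ)) : IsRecession A θ := by
  intro y hy s hs
  have h1 : Tendsto (fun k => y + s • (‖x k‖⁻¹ • x k) - (s * ‖x k‖⁻¹) • y) atTop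
      (𝓝 (y + s • θ - (s * 0) • y)) :=
    ((hθ.const_smul s).const_add y).sub ((hinf.inv_tendsto_atTop.const_mul s).smul_const y)
  rw [mul_zero, zero_smul, sub_zero] at h1
  refine hA.mem_of_tendsto h1 ?_
  filter_upwards [hinf.eventually_ge_atTop (max s 1)] with k hk
  have hpos : 0 < ‖x k‖ := by linarith [le_max_right s 1]
  have hle : s * ‖x k‖⁻¹ ≤ 1 := by
    rw [← div_eq_mul_inv, div_le_one hpos]
    exact (le_max_left _ _).trans hk
  have h2 := hc.add_smul_sub_mem hy (hx k) ⟨by positivity, hle⟩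
  convert h2 using 1
  rw [smul_sub, smul_smul]
  abel

/-- A divergent sequence in a closed convex set has a recession direction as a limit direction. -/
theorem exists_isRecession_of_tendsto_norm {n : ℕ} {A S : Set (Space n)} (hA : IsClosed A)
    (hc : Convex ℝ A) (hS : IsCompact S) {x u : ℕ → Space n} (hx : ∀ k, x k ∈ A)
    (hu : ∀ k, u k ∈ S) (hinf : Tendsto (fun k => ‖x k‖) atTop atTop) :
    ∃ θ, ‖θ‖ = 1 ∧ IsRecession A θ ∧ ∃ v ∈ S, ∃ φ : ℕ → ℕ, StrictMono φ ∧
      Tendsto (fun k => ‖x (φ k)‖⁻¹ • x (φ k)) atTop (𝓝 θ) ∧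
      Tendsto (fun k => u (φ k)) atTop (𝓝 v) := by
  -- Compactness of the product gives one subsequence for both the directions and the vectors u, so
  -- that their pairings pass to the limit.
  have hcpt : IsCompact (Metric.closedBall (0 : Space n) 1 ×ˢ S) :=
    (isCompact_closedBall 0 1).prod hS
  have hmem : ∀ k, (‖x k‖⁻¹ • x k, u k) ∈ Metric.closedBall (0 : Space n) 1 ×ˢ S := by
    intro k
    refine ⟨?_, hu k⟩
    rw [mem_closedBall_zero_iff, norm_smul, norm_inv, norm_norm]
    exact inv_mul_le_one
  obtain ⟨⟨θ, v⟩, hmem', φ, hφ, hlim⟩ := hcpt.tendsto_subseq hmem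
  have h1 : Tendsto (fun k => ‖x (φ k)‖⁻¹ • x (φ k)) atTop (𝓝 θ) :=
    (continuous_fst.tendsto _).comp hlim
  have h2 : Tendsto (fun k => u (φ k)) atTop (𝓝 v) := (continuous_snd.tendsto _).comp hlim
  have hinf' := hinf.comp hφ.tendsto_atTop
  refine ⟨θ, ?_, isRecession_of_tendsto hA hc (fun k => hx (φ k)) hinf' h1, v, hmem'.2, φ, hφ,
    h1, h2⟩
  refine tendsto_nhds_unique h1.norm (tendsto_const_nhds.congr' ?_)
  filter_upwards [hinf'.eventually_gt_atTop 0] with k hk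
  simp only [Function.comp_apply] at hk
  rw [norm_smul, norm_inv, norm_norm, inv_mul_cancel₀ hk.ne']

/-- The ray from 0 in direction θ stays in A(K), so a horizontal θ would make the compact base
unbounded. -/
theorem MemCc.height_pos_of_isRecession {n : ℕ} {K : Set (Space n)} (hK : MemCc K) {θ : Space n}
    (hθ : IsRecession (asymptoticSet K) θ) (hθ1 : ‖θ‖ = 1) : 0 < height θ := by
  have h0 : ∀ s : ℝ, 0 ≤ s → s • θ ∈ asymptoticSet K := fun s hs => by
    simpa using hθ 0 hK.zero_mem s hs
  have hnn : 0 ≤ height θ := by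
    simpa using height_nonneg_of_mem_asymptoticSet (h0 1 zero_le_one)
  refine lt_of_le_of_ne hnn fun heq => ?_
  obtain ⟨R, hR⟩ := hK.compact_base.isBounded.exists_norm_le
  have h1 := hR ((|R| + 1) • θ) ⟨h0 _ (by positivity), by
    change height _ = 0
    rw [height_smul, ← heq, mul_zero]⟩
  rw [norm_smul, hθ1, Real.norm_eq_abs, abs_of_nonneg (by positivity)] at h1
  linarith [le_abs_self R]

/-- An unbounded sequence of bounded height would produce a recession direction of non-positive
height. -/
theorem MemCc.isBounded_slab {n : ℕ} (hn : 1 ≤ n) {K : Set (Space n)} (hK : MemCc K) (T : ℝ) :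
    Bornology.IsBounded (asymptoticSet K ∩ {x | height x ≤ T}) := by
  by_contra hb
  have hex : ∀ k : ℕ, ∃ x ∈ asymptoticSet K ∩ {x | height x ≤ T}, (k : ℝ) < ‖x‖ := by
    intro k
    by_contra! h
    exact hb (isBounded_iff_forall_norm_le.2 ⟨k, h⟩)
  choose x hx hxk using hex
  have hinf : Tendsto (fun k => ‖x k‖) atTop atTop :=
    tendsto_atTop_mono (fun k => (hxk k).le) tendsto_natCast_atTop_atTop
  obtain ⟨θ, hθ1, hθ, -, -, φ, hφ, hlim, -⟩ := exists_isRecession_of_tendsto_norm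
    (isClosed_asymptoticSet K) (hK.convex_asymptoticSet hn) (isCompact_singleton (x := (0 : Space n)))
    (fun k => (hx k).1) (u := fun _ => 0) (fun _ => rfl) hinf
  have h1 := (continuous_height.tendsto θ).comp hlim
  have h2 : Tendsto (fun k => ‖x (φ k)‖⁻¹ * T) atTop (𝓝 (0 * T)) :=
    ((hinf.comp hφ.tendsto_atTop).inv_tendsto_atTop).mul_const T
  have h3 := le_of_tendsto_of_tendsto' h1 h2 fun k => by
    simp only [Function.comp_apply, height_smul]
    exact mul_le_mul_of_nonneg_left (hx (φ k)).2 (by positivity)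
  linarith [hK.height_pos_of_isRecession hθ hθ1]

/-- Approximate w by y_k outside A(K). Each y_k is excluded by a supporting half-space of K at a
boundary point x_k of height at least k + 1, with normal u_k. Limits of u_k and x_k/‖x_k‖ give v and
θ. From 0 ≤ ⟨x_k, u_k⟩ < ⟨y_k, u_k⟩, where the right side stays bounded, division by ‖x_k‖ gives ⟨θ,
v⟩ = 0. -/
theorem MemCc.exists_normal_orthogonal_recession {n : ℕ} (hn : 1 ≤ n) {K : Set (Space n)}
    (hK : MemCc K) {w : Space n} (hw : w ∈ frontier (asymptoticSet K)) (hpos : 0 < height w) :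
    ∃ v θ, IsUnitNormal (asymptoticSet K) w v ∧ IsRecession (asymptoticSet K) θ ∧ ‖θ‖ = 1 ∧
      ⟪θ, v⟫ = 0 := by
  have hint := hK.exists_interior_height hn
  have hcl : w ∈ closure ({y | 0 < height y} ∩ (asymptoticSet K)ᶜ) := by
    rw [frontier_eq_closure_inter_closure] at hw
    exact (isOpen_lt continuous_const continuous_height).inter_closure ⟨hpos, hw.2⟩
  obtain ⟨y, hy, hylim⟩ := mem_closure_iff_seq_limit.1 hcl
  have hex : ∀ k : ℕ, ∃ x u, x ∈ frontier K ∧ (k : ℝ) + 1 ≤ height x ∧ IsUnitNormal K x u ∧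
      ⟪x, u⟫ < ⟪y k, u⟫ ∧ ∀ z ∈ asymptoticSetAt K ((k : ℝ) + 1), ⟪z, u⟫ ≤ ⟪x, u⟫ := by
    intro k
    have hk : (0 : ℝ) < (k : ℝ) + 1 := by positivity
    have ht : 0 < max ((k : ℝ) + 1) (height (y k)) := lt_max_of_lt_left hk
    have hnot : y k ∉ asymptoticSetAt K (max ((k : ℝ) + 1) (height (y k))) := fun h =>
      (hy k).2 (asymptoticSetAt_subset_asymptoticSet K ht h)
    have h0 : 0 < height (y k) := (hy k).1
    simp only [asymptoticSetAt, Set.mem_ofPred_eq, not_and, not_forall, not_le] at hnot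
    obtain ⟨x, hx, hxt, u, hu, hlt⟩ := hnot h0.le (le_max_right _ _)
    refine ⟨x, u, hx, hxt ▸ le_max_left _ _, hu, hlt, fun z hz => ?_⟩
    exact (asymptoticSetAt_mono hK.convex hint hk (le_max_left _ _) hz).2.2 x hx hxt u hu
  choose x u hx hxk hu hlt hz using hex
  have hxA : ∀ k, x k ∈ asymptoticSet K := fun k => hK.closure_subset (hx k).1
  have hinf : Tendsto (fun k => ‖x k‖) atTop atTop := by
    refine tendsto_atTop_mono (fun k => ?_) tendsto_natCast_atTop_atTop
    have := abs_height_le (x k)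
    have := le_abs_self (height (x k))
    linarith [hxk k]
  obtain ⟨θ, hθ1, hθ, v, hv, φ, hφ, hlim, hulim⟩ := exists_isRecession_of_tendsto_norm
    (isClosed_asymptoticSet K) (hK.convex_asymptoticSet hn) (isCompact_sphere (0 : Space n) 1)
    hxA (u := u) (fun k => by simpa using (hu k).1) hinf
  have hyφ : Tendsto (fun k => y (φ k)) atTop (𝓝 w) := hylim.comp hφ.tendsto_atTop
  have hyu : Tendsto (fun k => ⟪y (φ k), u (φ k)⟫) atTop (𝓝 ⟪w, v⟫) := hyφ.inner hulim
  refine ⟨v, θ, ⟨by simpa using hv, ?_⟩, hθ, hθ1, ?_⟩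
  · have hc : IsClosed {z : Space n | ⟪z, v⟫ ≤ ⟪w, v⟫} := isClosed_le (by fun_prop) (by fun_prop)
    refine fun z hz' => closure_minimal (fun z hz' => ?_) hc hz'
    simp only [Set.mem_iUnion] at hz'
    obtain ⟨s, hs, hzs⟩ := hz'
    have h1 : Tendsto (fun k => ⟪z, u (φ k)⟫) atTop (𝓝 ⟪z, v⟫) := tendsto_const_nhds.inner hulim
    refine le_of_tendsto_of_tendsto h1 hyu ?_
    obtain ⟨N, hN⟩ := exists_nat_ge s
    filter_upwards [eventually_ge_atTop N] with k hk
    have h2 : s ≤ (φ k : ℝ) + 1 := by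
      have : (N : ℝ) ≤ φ k := by exact_mod_cast hk.trans (hφ.id_le k)
      linarith
    exact (hz _ z (asymptoticSetAt_mono hK.convex hint hs h2 hzs)).trans (hlt _).le
  · have h1 : Tendsto (fun k => ⟪‖x (φ k)‖⁻¹ • x (φ k), u (φ k)⟫) atTop (𝓝 ⟪θ, v⟫) :=
      hlim.inner hulim
    have h2 : Tendsto (fun k => ‖x (φ k)‖⁻¹ * ⟪y (φ k), u (φ k)⟫) atTop (𝓝 (0 * ⟪w, v⟫)) :=
      ((hinf.comp hφ.tendsto_atTop).inv_tendsto_atTop).mul hyu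
    rw [zero_mul] at h2
    refine tendsto_nhds_unique h1 (tendsto_of_tendsto_of_tendsto_of_le_of_le tendsto_const_nhds h2
      (fun k => ?_) (fun k => ?_))
    · have := (hu (φ k)).inner_le_of_mem_closure hK.zero_mem_closure
      rw [inner_zero_left] at this
      rw [real_inner_smul_left]
      positivity
    · simp only [real_inner_smul_left]
      exact mul_le_mul_of_nonneg_left (hlt _).le (by positivity)

/-- The asymptotic boundary set does not change when `A(K)` is cut off in a bounded region. -/
theorem MemCc.asymptoticSet_eq {n : ℕ} (hn : 1 ≤ n) {K L : Set (Space n)} (hK : MemCc K)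
    (hLcl : IsClosed L) (hL : Convex ℝ L) (hLA : L ⊆ asymptoticSet K) (h0 : (0 : Space n) ∈ L)
    {T : ℝ} (hT : ∀ x ∈ asymptoticSet K, T ≤ height x → x ∈ L) :
    asymptoticSet L = asymptoticSet K := by
  have hA := hK.convex_asymptoticSet hn
  have hLint : (interior L).Nonempty := by
    obtain ⟨p, hp, hpt⟩ := hK.exists_interior_height hn (|T| + 1) (by positivity)
    refine ⟨p, interior_maximal (s := L) (t := interior K ∩ {y | T < height y}) ?_
      (isOpen_interior.inter (isOpen_lt continuous_const continuous_height)) ⟨hp, ?_⟩⟩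
    · rintro y ⟨hy, hyT⟩
      exact hT y (hK.closure_subset (subset_closure (interior_subset hy))) (le_of_lt hyT)
    · change T < height p
      linarith [le_abs_self T]
  have hint : ∀ t : ℝ, 0 < t → ∃ p ∈ interior L, height p = t := by
    refine Coconvex.exists_interior_height hL hLint (subset_closure h0) fun S => ?_
    obtain ⟨p, hp, hpt⟩ := hK.exists_interior_height hn (max (max S T) 1) (by positivity)
    refine ⟨p, subset_closure (hT p (hK.closure_subset (subset_closure (interior_subset hp))) ?_),
      ?_⟩ <;> rw [hpt] <;> simp
  apply Set.Subset.antisymm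
  -- A point y ∈ A_s(L) outside A(K) is separated from it at a boundary point w by a normal v
  -- orthogonal to a recession direction θ. Sliding w along θ above height T reaches a point of L
  -- where v is still normal, and there it excludes y.
  · refine closure_minimal (fun y hy => ?_) (isClosed_asymptoticSet K)
    simp only [Set.mem_iUnion] at hy
    obtain ⟨s, hs, hy⟩ := hy
    by_contra hyA
    -- Positive height of p ensures that the crossing point w has positive height.
    obtain ⟨p, hp, hp1⟩ := hK.exists_interior_height hn 1 one_pos
    have hpA : p ∈ interior (asymptoticSet K) :=
      interior_mono (subset_closure.trans hK.closure_subset) hp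
    rw [← (isClosed_asymptoticSet K).closure_eq] at hyA
    obtain ⟨c, hc0, hc1, hw⟩ := exists_frontier_between hpA hyA
    set w := p + c • (y - p) with hwdef
    have hwpos : 0 < height w := by
      rw [hwdef, height_add, height_smul, height_sub, hp1]
      nlinarith [mul_nonneg hc0.le hy.1]
    obtain ⟨v, θ, hv, hθ, hθ1, hθv⟩ := hK.exists_normal_orthogonal_recession hn hw hwpos
    have hθpos := hK.height_pos_of_isRecession hθ hθ1
    set t := max s (max T (height w)) with ht
    have hs' : 0 < s := hs
    have hyt : y ∈ asymptoticSetAt L t := asymptoticSetAt_mono hL hint hs' (le_max_left _ _) hy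
    have htw : height w ≤ t := (le_max_right _ _).trans (le_max_right _ _)
    set x := w + ((t - height w) / height θ) • θ with hxdef
    have hxA : x ∈ asymptoticSet K := by
      refine hθ w ?_ _ (div_nonneg (by linarith) hθpos.le)
      rw [← (isClosed_asymptoticSet K).closure_eq]
      exact hw.1
    have hxt : height x = t := by
      rw [hxdef, height_add, height_smul]; field_simp; ring
    have hxL : x ∈ L := hT x hxA (hxt ▸ (le_max_left _ _).trans (le_max_right _ _))
    have hxv : ⟪x, v⟫ = ⟪w, v⟫ := by
      rw [hxdef, inner_add_left, real_inner_smul_left, hθv, mul_zero, add_zero]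
    have hxn : IsUnitNormal L x v := ⟨hv.1, fun z hz => hxv ▸ hv.2 z (hLA hz)⟩
    have hxf : x ∈ frontier L := ⟨subset_closure hxL, fun hi =>
      lt_irrefl _ (hxn.inner_lt_of_mem_interior hi)⟩
    have h1 := hyt.2.2 x hxf hxt v hxn
    have h2 := hv.inner_lt_of_between hpA hc0 hc1
    rw [← hwdef] at h2
    linarith
  -- At a boundary point of L above height T, L agrees nearby with the convex set A(K), so a
  -- supporting half-space of L contains all of A(K).
  · intro z hz
    set t := max (T + 1) (max 1 (height z)) with ht
    have ht0 : 0 < t := lt_max_of_lt_right (lt_max_of_lt_left one_pos)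
    refine asymptoticSetAt_subset_asymptoticSet L ht0
      ⟨height_nonneg_of_mem_asymptoticSet hz, (le_max_right _ _).trans (le_max_right _ _), ?_⟩
    intro x hx hxt u hu
    have hxL : x ∈ L := hLcl.closure_eq ▸ hx.1
    have hTt : T < height x := by
      have := le_max_left (T + 1) (max 1 (height z))
      rw [hxt, ht]; linarith
    have hlim : Tendsto (fun ε : ℝ => height (x + ε • (z - x))) (𝓝[>] 0) (𝓝 (height x)) := by
      have : Tendsto (fun ε : ℝ => height (x + ε • (z - x))) (𝓝 0)
          (𝓝 (height (x + (0 : ℝ) • (z - x)))) :=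
        (continuous_height.comp (by fun_prop)).tendsto 0
      rw [zero_smul, add_zero] at this
      exact this.mono_left nhdsWithin_le_nhds
    obtain ⟨ε, hε, hε0, hε1⟩ := ((hlim.eventually (lt_mem_nhds hTt)).and
      (Ioo_mem_nhdsGT (zero_lt_one' ℝ))).exists
    have hmem : x + ε • (z - x) ∈ L :=
      hT _ (hA.add_smul_sub_mem (hLA hxL) hz ⟨hε0.le, hε1.le⟩) hε.le
    have h1 := hu.2 _ hmem
    rw [inner_add_left, real_inner_smul_left, inner_sub_left] at h1
    have h2 : ε * (⟪z, u⟫ - ⟪x, u⟫) ≤ 0 := by linarith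
    nlinarith [nonpos_of_mul_nonpos_right h2 hε0]

/-! ### Consequences of finite covolume. -/

/-- If ⟨θ, u⟩ > 0, translates along θ of a ball in K stay in A(K) but leave K once ⟨·, u⟩ exceeds
its bound there. Infinitely many disjoint ones would have infinite volume. -/
theorem MemCb.inner_nonpos_of_isRecession {n : ℕ} {D K : Set (Space n)} (hK : MemCb D K)
    {θ u : Space n} (hθ : IsRecession (asymptoticSet K) θ) (hθ1 : ‖θ‖ = 1) (hu : u ∈ D) :
    ⟪θ, u⟫ ≤ 0 := by
  by_contra! hpos
  obtain ⟨p, hp⟩ := hK.interior_nonempty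
  obtain ⟨r, hr, hball⟩ := Metric.isOpen_iff.1 isOpen_interior p hp
  obtain ⟨M, hM⟩ := hK.support_finite u hu
  have hu1 : ‖u‖ = 1 := (hK.domain.subset_lower hu).1
  -- Translation by s₀ moves the entire ball beyond the bound M; further steps of length 2r keep the
  -- balls disjoint, as ‖θ‖ = 1.
  set s₀ : ℝ := max 0 ((M + r - ⟪p, u⟫) / ⟪θ, u⟫) with hs₀
  have hs₀0 : 0 ≤ s₀ := le_max_left _ _
  set B : ℕ → Set (Space n) := fun k => Metric.ball (p + (s₀ + 2 * r * k) • θ) r with hB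
  have hsub : ∀ k, B k ⊆ coconvexSet K := by
    intro k y hy
    have hk : 0 ≤ 2 * r * k := by positivity
    set y' := y - (s₀ + 2 * r * k) • θ with hy'
    have hy'b : y' ∈ Metric.ball p r := by
      rw [mem_ball_iff_norm] at hy ⊢
      convert hy using 2
      rw [hy']; abel
    have hyy : y = y' + (s₀ + 2 * r * k) • θ := by rw [hy']; abel
    constructor
    · rw [hyy]
      exact hθ y' (hK.closure_subset (subset_closure (interior_subset (hball hy'b)))) _
        (by positivity)
    · intro hyK
      have h1 : ⟪y, u⟫ ≤ M := hM ⟨y, hyK, rfl⟩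
      have h2 : ⟪p - y', u⟫ < r := by
        calc ⟪p - y', u⟫ ≤ ‖p - y'‖ * ‖u‖ := real_inner_le_norm _ _
          _ < r := by rw [hu1, mul_one, ← mem_ball_iff_norm']; exact hy'b
      have h3 : M + r - ⟪p, u⟫ ≤ s₀ * ⟪θ, u⟫ := by
        rw [← div_le_iff₀ hpos]; exact le_max_right _ _
      rw [inner_sub_left] at h2
      rw [hyy, inner_add_left, real_inner_smul_left] at h1
      nlinarith [mul_nonneg hk hpos.le]
  have hdisj : Pairwise (Function.onFun Disjoint B) := by
    intro i j hij
    refine Metric.ball_disjoint_ball ?_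
    rw [dist_add_left, dist_eq_norm, ← sub_smul, norm_smul, hθ1, mul_one, Real.norm_eq_abs]
    have h1 : (1 : ℝ) ≤ |(i : ℝ) - j| := by
      have : (1 : ℤ) ≤ |(i : ℤ) - j| := Int.one_le_abs (sub_ne_zero.2 (by exact_mod_cast hij))
      exact_mod_cast this
    have h2 : s₀ + 2 * r * i - (s₀ + 2 * r * j) = 2 * r * (i - j) := by ring
    rw [h2, abs_mul, abs_of_pos (by positivity)]
    nlinarith
  have hvol : volume (⋃ k, B k) = ⊤ := by
    rw [measure_iUnion hdisj fun k => measurableSet_ball]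
    have : ∀ k, volume (B k) = volume (Metric.ball (0 : Space n) r) := fun k =>
      Measure.addHaar_ball_center volume _ r
    simp only [this]
    exact ENNReal.tsum_const_eq_top_of_ne_zero (Metric.measure_ball_pos volume 0 hr).ne'
  have := (measure_mono (Set.iUnion_subset hsub)).trans_lt hK.finite_covolume
  rw [hvol] at this
  exact lt_irrefl _ this

/-- D is relatively open, so the weak inequality also holds for the normalised u + εθ, giving ⟨θ, u⟩
+ ε ≤ 0. -/
theorem MemCb.inner_neg_of_isRecession {n : ℕ} {D K : Set (Space n)} (hK : MemCb D K)
    {θ u : Space n} (hθ : IsRecession (asymptoticSet K) θ) (hθ1 : ‖θ‖ = 1) (hu : u ∈ D) :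
    ⟪θ, u⟫ < 0 := by
  obtain ⟨U, hU, hDU⟩ := hK.domain.rel_open
  have hu1 : ‖u‖ = 1 := (hK.domain.subset_lower hu).1
  have hlim : Tendsto (fun ε : ℝ => ‖u + ε • θ‖⁻¹ • (u + ε • θ)) (𝓝[>] 0) (𝓝 u) := by
    have hc : Tendsto (fun ε : ℝ => u + ε • θ) (𝓝 0) (𝓝 (u + (0 : ℝ) • θ)) :=
      Continuous.tendsto (by fun_prop) 0
    rw [zero_smul, add_zero] at hc
    have h2 := (hc.norm.inv₀ (by rw [hu1]; exact one_ne_zero)).smul hc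
    rw [hu1, inv_one, one_smul] at h2
    exact h2.mono_left nhdsWithin_le_nhds
  have hlim1 : Tendsto (fun ε : ℝ => ‖u + ε • θ‖) (𝓝[>] 0) (𝓝 1) := by
    have hc : Tendsto (fun ε : ℝ => u + ε • θ) (𝓝 0) (𝓝 (u + (0 : ℝ) • θ)) :=
      Continuous.tendsto (by fun_prop) 0
    rw [zero_smul, add_zero] at hc
    have := hc.norm
    rw [hu1] at this
    exact this.mono_left nhdsWithin_le_nhds
  have huU : u ∈ U := (hDU ▸ hu : u ∈ U ∩ Metric.sphere 0 1).1
  obtain ⟨ε, ⟨hεU, hεn⟩, hε⟩ := (((hlim.eventually (hU.mem_nhds huU)).and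
    (hlim1.eventually (lt_mem_nhds zero_lt_one))).and self_mem_nhdsWithin).exists
  have hε0 : (0 : ℝ) < ε := hε
  have hmem : ‖u + ε • θ‖⁻¹ • (u + ε • θ) ∈ D := by
    rw [hDU]
    refine ⟨hεU, ?_⟩
    rw [mem_sphere_zero_iff_norm, norm_smul, norm_inv, norm_norm, inv_mul_cancel₀ hεn.ne']
  have h := hK.inner_nonpos_of_isRecession hθ hθ1 hmem
  rw [real_inner_smul_right, inner_add_right, real_inner_smul_right, real_inner_self_eq_norm_sq,
    hθ1] at h
  have := nonpos_of_mul_nonpos_right h (inv_pos.2 hεn)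
  linarith

/-- A violating sequence of heights tending to infinity would yield a recession direction θ and v ∈
ω with ⟨θ, v⟩ ≥ 0. With C = 0 this confines all cutting by ω to a bounded slab. -/
theorem MemCb.exists_height_inner_le {n : ℕ} (hn : 1 ≤ n) {D K ω : Set (Space n)} (hK : MemCb D K)
    (hω : IsCompact ω) (hωD : ω ⊆ D) (C : ℝ) :
    ∃ T : ℝ, ∀ x ∈ asymptoticSet K, T ≤ height x → ∀ u ∈ ω, ⟪x, u⟫ ≤ C := by
  by_contra! hno
  choose! x hx hxT u hu hlt using fun k : ℕ => hno k
  have hinf : Tendsto (fun k => ‖x k‖) atTop atTop := by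
    refine tendsto_atTop_mono (fun k => ?_) tendsto_natCast_atTop_atTop
    exact (hxT k).trans ((le_abs_self _).trans (abs_height_le _))
  obtain ⟨θ, hθ1, hθ, v, hv, φ, hφ, hlim, hulim⟩ := exists_isRecession_of_tendsto_norm
    (isClosed_asymptoticSet K) (hK.convex_asymptoticSet hn) hω hx hu hinf
  have h1 : Tendsto (fun k => ⟪‖x (φ k)‖⁻¹ • x (φ k), u (φ k)⟫) atTop (𝓝 ⟪θ, v⟫) :=
    hlim.inner hulim
  have h2 : Tendsto (fun k => ‖x (φ k)‖⁻¹ * C) atTop (𝓝 (0 * C)) :=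
    ((hinf.comp hφ.tendsto_atTop).inv_tendsto_atTop).mul_const C
  have h3 := le_of_tendsto_of_tendsto' h2 h1 fun k => by
    rw [real_inner_smul_left]
    exact mul_le_mul_of_nonneg_left (hlt _).le (by positivity)
  linarith [hK.inner_neg_of_isRecession hθ hθ1 (hωD hv)]

/-! ### Continuity of the support function. -/

theorem inner_le_supportFun {n : ℕ} {K : Set (Space n)} {u x : Space n}
    (hb : BddAbove ((fun x => ⟪x, u⟫) '' K)) (hx : x ∈ K) : ⟪x, u⟫ ≤ supportFun K u :=
  le_csSup hb ⟨x, hx, rfl⟩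

theorem supportFun_le {n : ℕ} {K : Set (Space n)} (hne : K.Nonempty) {u : Space n} {M : ℝ}
    (h : ∀ x ∈ K, ⟪x, u⟫ ≤ M) : supportFun K u ≤ M := by
  refine csSup_le (hne.image _) ?_
  rintro _ ⟨x, hx, rfl⟩
  exact h x hx

theorem MemC0.nonempty {n : ℕ} {K : Set (Space n)} (hK : MemC0 K) : K.Nonempty :=
  hK.interior_nonempty.mono interior_subset

/-- On the open convex cone over D the support function is finite and convex, hence continuous. -/
theorem MemCcOn.continuousOn_supportFun {n : ℕ} {D K : Set (Space n)} (hK : MemCcOn D K) :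
    ContinuousOn (supportFun K) D := by
  set C : Set (Space n) := {x | ‖x‖⁻¹ • x ∈ D} with hC
  have hne := hK.nonempty
  have hneg : ∀ x ∈ C, height x < 0 := by
    intro x hx
    have h1 := (hK.domain.subset_lower hx).2
    rw [height_smul] at h1
    by_contra! h2
    have : 0 ≤ ‖x‖⁻¹ * height x := by positivity
    linarith
  have hDC : D ⊆ C := by
    intro u hu
    change ‖u‖⁻¹ • u ∈ D
    rwa [(hK.domain.subset_lower hu).1, inv_one, one_smul]
  have hCconv : Convex ℝ C := by
    -- The domain hypothesis adjoins the apex; intersecting with the open lower half-space removes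
    -- it and keeps convexity.
    have h1 : C = (C ∪ {0}) ∩ {x | height x < 0} := by
      ext x
      constructor
      · exact fun hx => ⟨Or.inl hx, hneg x hx⟩
      · rintro ⟨hx | hx, hx'⟩
        · exact hx
        · rw [Set.mem_singleton_iff] at hx
          subst hx
          exact absurd (show height (0 : Space n) < 0 from hx') (by simp [height])
    rw [h1]
    refine hK.domain.convex_cone.inter ?_
    intro x hx y hy a b ha hb hab
    change height _ < 0
    change height x < 0 at hx
    change height y < 0 at hy
    rw [height_add, height_smul, height_smul]
    rcases ha.eq_or_lt with rfl | ha
    · rw [zero_add] at hab; subst hab; linarith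
    · nlinarith [mul_neg_of_pos_of_neg ha hx, mul_nonpos_of_nonneg_of_nonpos hb hy.le]
  have hCopen : IsOpen C := by
    obtain ⟨U, hU, hDU⟩ := hK.domain.rel_open
    rw [isOpen_iff_mem_nhds]
    intro x hx
    have hx0 : x ≠ 0 := by
      rintro rfl
      exact absurd (hneg _ hx) (by simp [height])
    have hcont : ContinuousAt (fun y : Space n => ‖y‖⁻¹ • y) x :=
      (continuousAt_id.norm.inv₀ (norm_ne_zero_iff.2 hx0)).smul continuousAt_id
    have hxU : ‖x‖⁻¹ • x ∈ U := (hDU ▸ hx : ‖x‖⁻¹ • x ∈ U ∩ Metric.sphere 0 1).1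
    filter_upwards [hcont.eventually (hU.mem_nhds hxU), isOpen_ne.mem_nhds hx0] with y hy hy0
    change _ ∈ D
    rw [hDU]
    refine ⟨hy, ?_⟩
    rw [mem_sphere_zero_iff_norm, norm_smul, norm_inv, norm_norm,
      inv_mul_cancel₀ (norm_ne_zero_iff.2 hy0)]
  have hbdd : ∀ x ∈ C, BddAbove ((fun z => ⟪z, x⟫) '' K) := by
    intro x hx
    have hx0 : 0 < ‖x‖ := by
      rw [norm_pos_iff]
      rintro rfl
      exact absurd (hneg _ hx) (by simp [height])
    obtain ⟨M, hM⟩ := hK.support_finite _ hx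
    refine ⟨‖x‖ * M, ?_⟩
    rintro _ ⟨z, hz, rfl⟩
    have h1 : ⟪z, ‖x‖⁻¹ • x⟫ ≤ M := hM ⟨z, hz, rfl⟩
    rw [real_inner_smul_right, inv_mul_le_iff₀ hx0] at h1
    exact h1
  have hconv : ConvexOn ℝ C (supportFun K) := by
    refine ⟨hCconv, fun x hx y hy a b ha hb hab => supportFun_le hne fun z hz => ?_⟩
    rw [inner_add_right, real_inner_smul_right, real_inner_smul_right, smul_eq_mul, smul_eq_mul]
    gcongr
    · exact inner_le_supportFun (hbdd x hx) hz
    · exact inner_le_supportFun (hbdd y hy) hz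
  exact (hconv.continuousOn hCopen).mono hDC

/-! ### The intersection of half-spaces as an epigraph. -/

/-- The affine function of `x` whose graph is the hyperplane `⟨·, u⟩ = g(u)`. -/
noncomputable def planeFun {n : ℕ} (g : Space n → ℝ) (u : Space n) (x : Base n) : ℝ :=
  (⟪x, horiz u⟫ - g u) / (-height u)

/-- The function whose epigraph is `⋂_{u ∈ ω} {⟨·, u⟩ ≤ g(u)}`. -/
noncomputable def lowerGraph {n : ℕ} (ω : Set (Space n)) (g : Space n → ℝ) (x : Base n) : ℝ :=
  sSup ((fun u => planeFun g u x) '' ω)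

theorem continuousOn_planeFun {n : ℕ} {ω : Set (Space n)} {g : Space n → ℝ}
    (hg : ContinuousOn g ω) (hneg : ∀ u ∈ ω, height u < 0) (x : Base n) :
    ContinuousOn (fun u => planeFun g u x) ω := by
  unfold planeFun
  refine ContinuousOn.div ?_ continuous_height.neg.continuousOn
    (fun u hu => (neg_pos.2 (hneg u hu)).ne')
  exact (continuous_const.inner continuous_horiz).continuousOn.sub hg

theorem exists_lowerGraph_eq {n : ℕ} {ω : Set (Space n)} {g : Space n → ℝ} (hω : IsCompact ω)
    (hne : ω.Nonempty) (hg : ContinuousOn g ω) (hneg : ∀ u ∈ ω, height u < 0) (x : Base n) :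
    ∃ u ∈ ω, lowerGraph ω g x = planeFun g u x := by
  obtain ⟨u, hu, h⟩ := hω.exists_sSup_image_eq hne (continuousOn_planeFun hg hneg x)
  exact ⟨u, hu, h⟩

theorem planeFun_le_lowerGraph {n : ℕ} {ω : Set (Space n)} {g : Space n → ℝ} (hω : IsCompact ω)
    (hg : ContinuousOn g ω) (hneg : ∀ u ∈ ω, height u < 0) (x : Base n) {u : Space n}
    (hu : u ∈ ω) : planeFun g u x ≤ lowerGraph ω g x :=
  le_csSup (hω.bddAbove_image (continuousOn_planeFun hg hneg x)) ⟨u, hu, rfl⟩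

theorem inner_join_le_iff {n : ℕ} {g : Space n → ℝ} {u : Space n} (hu : height u < 0) (x : Base n)
    (z : ℝ) : ⟪join (x, z), u⟫ ≤ g u ↔ planeFun g u x ≤ z := by
  rw [inner_join_left, planeFun, div_le_iff₀ (neg_pos.2 hu)]
  constructor <;> intro h <;> linarith

theorem forall_inner_join_le_iff {n : ℕ} {ω : Set (Space n)} {g : Space n → ℝ} (hω : IsCompact ω)
    (hne : ω.Nonempty) (hg : ContinuousOn g ω) (hneg : ∀ u ∈ ω, height u < 0) (x : Base n)
    (z : ℝ) : (∀ u ∈ ω, ⟪join (x, z), u⟫ ≤ g u) ↔ lowerGraph ω g x ≤ z := by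
  constructor
  · intro h
    obtain ⟨u, hu, he⟩ := exists_lowerGraph_eq hω hne hg hneg x
    rw [he]
    exact (inner_join_le_iff (hneg u hu) x z).1 (h u hu)
  · intro h u hu
    exact (inner_join_le_iff (hneg u hu) x z).2
      ((planeFun_le_lowerGraph hω hg hneg x hu).trans h)

theorem exists_pos_le_neg_height {n : ℕ} {ω : Set (Space n)} (hω : IsCompact ω)
    (hneg : ∀ u ∈ ω, height u < 0) : ∃ c : ℝ, 0 < c ∧ ∀ u ∈ ω, c ≤ -height u := by
  obtain ⟨c, hc, h⟩ := hω.exists_forall_le' (continuous_height.neg.continuousOn) (a := 0)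
    (fun u hu => neg_pos.2 (hneg u hu))
  exact ⟨c, hc, h⟩

theorem lowerGraph_le_of_planeFun_le {n : ℕ} {ω : Set (Space n)} {g g' : Space n → ℝ}
    (hω : IsCompact ω) (hne : ω.Nonempty) (hg : ContinuousOn g ω) (hg' : ContinuousOn g' ω)
    (hneg : ∀ u ∈ ω, height u < 0) (x y : Base n) (d : ℝ)
    (h : ∀ u ∈ ω, planeFun g u x ≤ planeFun g' u y + d) :
    lowerGraph ω g x ≤ lowerGraph ω g' y + d := by
  obtain ⟨u, hu, he⟩ := exists_lowerGraph_eq hω hne hg hneg x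
  rw [he]
  exact (h u hu).trans (by gcongr; exact planeFun_le_lowerGraph hω hg' hneg y hu)

theorem exists_lipschitzWith_lowerGraph {n : ℕ} {ω : Set (Space n)} {g : Space n → ℝ}
    (hω : IsCompact ω) (hne : ω.Nonempty) (hg : ContinuousOn g ω)
    (hω1 : ω ⊆ lowerHemisphere n) : ∃ C : ℝ≥0, LipschitzWith C (lowerGraph ω g) := by
  have hneg : ∀ u ∈ ω, height u < 0 := fun u hu => (hω1 hu).2
  obtain ⟨c, hc, hcω⟩ := exists_pos_le_neg_height hω hneg
  refine ⟨.mk c⁻¹ (by positivity), LipschitzWith.of_le_add_mul _ fun x y => ?_⟩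
  refine lowerGraph_le_of_planeFun_le hω hne hg hg hneg x y _ fun u hu => ?_
  have h0 : 0 < -height u := hc.trans_le (hcω u hu)
  have h1 : planeFun g u x - planeFun g u y = ⟪x - y, horiz u⟫ / (-height u) := by
    rw [planeFun, planeFun, inner_sub_left]; ring
  have h2 : ⟪x - y, horiz u⟫ ≤ ‖x - y‖ := by
    calc ⟪x - y, horiz u⟫ ≤ ‖x - y‖ * ‖horiz u‖ := real_inner_le_norm _ _
      _ ≤ ‖x - y‖ * 1 := by
        gcongr
        exact (norm_horiz_le u).trans_eq (hω1 hu).1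
      _ = _ := mul_one _
  have h3 : ⟪x - y, horiz u⟫ / (-height u) ≤ c⁻¹ * dist x y := by
    rw [div_le_iff₀ h0, dist_eq_norm]
    calc ⟪x - y, horiz u⟫ ≤ ‖x - y‖ := h2
      _ = c⁻¹ * ‖x - y‖ * c := by field_simp
      _ ≤ c⁻¹ * ‖x - y‖ * -height u := by gcongr; exact hcω u hu
  rw [NNReal.coe_mk]
  linarith

theorem planeFun_add_mul {n : ℕ} (h f : Space n → ℝ) (τ : ℝ) (u : Space n) (x : Base n) :
    planeFun (fun v => h v + τ * f v) u x = planeFun h u x - τ * (f u / (-height u)) := by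
  rw [planeFun, planeFun]; ring

/-- The constant bounds |f(u)/⟨u, eₙ₊₁⟩| on ω and does not depend on x, as domination requires. -/
theorem exists_lowerGraph_lipschitz_param {n : ℕ} {ω : Set (Space n)} {h f : Space n → ℝ}
    (hω : IsCompact ω) (hne : ω.Nonempty) (hh : ContinuousOn h ω) (hf : ContinuousOn f ω)
    (hneg : ∀ u ∈ ω, height u < 0) :
    ∃ C : ℝ≥0, ∀ x, LipschitzWith C (fun τ : ℝ => lowerGraph ω (fun v => h v + τ * f v) x) := by
  have hq : ContinuousOn (fun u => f u / (-height u)) ω :=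
    hf.div continuous_height.neg.continuousOn (fun u hu => (neg_pos.2 (hneg u hu)).ne')
  obtain ⟨C, hC⟩ := hω.exists_bound_of_continuousOn hq
  have hgτ : ∀ τ : ℝ, ContinuousOn (fun v => h v + τ * f v) ω := fun τ =>
    hh.add (continuousOn_const.mul hf)
  refine ⟨.mk |C| (abs_nonneg C), fun x => LipschitzWith.of_le_add_mul _ fun τ σ => ?_⟩
  refine lowerGraph_le_of_planeFun_le hω hne (hgτ τ) (hgτ σ) hneg x x _ fun u hu => ?_
  rw [planeFun_add_mul, planeFun_add_mul, NNReal.coe_mk]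
  have h1 : |(σ - τ) * (f u / (-height u))| ≤ |C| * dist τ σ := by
    rw [abs_mul, mul_comm |σ - τ|, dist_comm, Real.dist_eq]
    exact mul_le_mul_of_nonneg_right ((hC u hu).trans (le_abs_self C)) (abs_nonneg _)
  have h2 := le_abs_self ((σ - τ) * (f u / (-height u)))
  linarith

/-! ### Uniqueness of the maximising normal and the parameter derivative. -/

/-- The downward unit normal vector of a graph of slope `p`. -/
noncomputable def slopeNormal {n : ℕ} (p : Base n →L[ℝ] ℝ) : Space n :=
  (graphDensity p)⁻¹ • join ((InnerProductSpace.toDual ℝ (Base n)).symm p, -1)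

theorem height_slopeNormal {n : ℕ} (p : Base n →L[ℝ] ℝ) :
    height (slopeNormal p) = -(graphDensity p)⁻¹ := by
  rw [slopeNormal, height_smul, height_join]; ring

theorem eq_slopeNormal {n : ℕ} {p : Base n →L[ℝ] ℝ} {u : Space n} (hu : ‖u‖ = 1)
    (hneg : height u < 0) (hp : ∀ v, p v * (-height u) = ⟪v, horiz u⟫) : u = slopeNormal p := by
  set c := -height u with hc
  have hc0 : 0 < c := neg_pos.2 hneg
  have hw : (InnerProductSpace.toDual ℝ (Base n)).symm p = c⁻¹ • horiz u := by
    refine ext_inner_right ℝ fun v => ?_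
    rw [InnerProductSpace.toDual_symm_apply, real_inner_smul_left, real_inner_comm, ← hp v]
    field_simp
  have hn : ‖p‖ ^ 2 = c⁻¹ ^ 2 * ‖horiz u‖ ^ 2 := by
    rw [← LinearIsometryEquiv.norm_map (InnerProductSpace.toDual ℝ (Base n)).symm p, hw, norm_smul,
      Real.norm_eq_abs, mul_pow, sq_abs]
  have h1 := norm_sq_eq_horiz u
  rw [hu] at h1
  have hd : graphDensity p = c⁻¹ := by
    rw [graphDensity, hn, Real.sqrt_eq_iff_mul_self_eq (by positivity) (by positivity)]
    have h2 : ‖horiz u‖ ^ 2 = 1 - c ^ 2 := by rw [hc]; linarith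
    rw [h2]
    field_simp
    ring
  rw [slopeNormal, hd, inv_inv, hw, ← map_smul]
  conv_lhs => rw [← join_horiz_height u]
  congr 1
  ext
  · simp [hc0.ne']
  · simp [hc]

/-- The maximum minus an active affine function has a minimum at x, so the two derivatives agree. -/
theorem fderiv_lowerGraph_mul {n : ℕ} {ω : Set (Space n)} {g : Space n → ℝ}
    (hω : IsCompact ω) (hg : ContinuousOn g ω) (hneg : ∀ u ∈ ω, height u < 0) {x : Base n}
    (hd : DifferentiableAt ℝ (lowerGraph ω g) x) {u : Space n} (hu : u ∈ ω)
    (he : lowerGraph ω g x = planeFun g u x) (v : Base n) :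
    fderiv ℝ (lowerGraph ω g) x v * (-height u) = ⟪v, horiz u⟫ := by
  have hA : HasFDerivAt (planeFun g u) ((-height u)⁻¹ • (innerSL ℝ (horiz u))) x := by
    have h1 : planeFun g u = fun y => (-height u)⁻¹ • (innerSL ℝ (horiz u) y - g u) := by
      ext y
      rw [planeFun, innerSL_apply_apply, real_inner_comm, smul_eq_mul, div_eq_inv_mul]
    rw [h1]
    exact (((innerSL ℝ (horiz u)).hasFDerivAt).sub_const (g u)).const_smul (-height u)⁻¹
  have hB := hd.hasFDerivAt.sub hA
  have hmin : IsLocalMin (lowerGraph ω g - planeFun g u) x := by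
    refine Eventually.of_forall fun y => ?_
    simp only [Pi.sub_apply]
    rw [he, sub_self, sub_nonneg]
    exact planeFun_le_lowerGraph hω hg hneg y hu
  have h0 := hmin.hasFDerivAt_eq_zero hB
  have h1 := congrArg (fun L : Base n →L[ℝ] ℝ => L v) h0
  have hc : -height u ≠ 0 := (neg_pos.2 (hneg u hu)).ne'
  simp only [FunLike.coe_sub, Pi.sub_apply, FunLike.coe_smul, Pi.smul_apply, innerSL_apply_apply, smul_eq_mul,
    zero_apply] at h1
  rw [real_inner_comm] at h1
  rw [sub_eq_zero.1 h1, mul_comm, mul_inv_cancel_left₀ hc]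

theorem eq_slopeNormal_of_lowerGraph_eq {n : ℕ} {ω : Set (Space n)} {g : Space n → ℝ}
    (hω : IsCompact ω) (hg : ContinuousOn g ω) (hω1 : ω ⊆ lowerHemisphere n) {x : Base n}
    (hd : DifferentiableAt ℝ (lowerGraph ω g) x) {u : Space n} (hu : u ∈ ω)
    (he : lowerGraph ω g x = planeFun g u x) :
    u = slopeNormal (fderiv ℝ (lowerGraph ω g) x) :=
  eq_slopeNormal (hω1 hu).1 (hω1 hu).2
    (fderiv_lowerGraph_mul hω hg (fun _ hu => (hω1 hu).2) hd hu he)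

/-- The derivative of the lower graph function with respect to the parameter, at a point where the
unperturbed function is differentiable. -/
theorem hasDerivAt_lowerGraph {n : ℕ} {ω : Set (Space n)} {h f : Space n → ℝ}
    (hω : IsCompact ω) (hne : ω.Nonempty) (hh : ContinuousOn h ω) (hf : ContinuousOn f ω)
    (hω1 : ω ⊆ lowerHemisphere n) {x : Base n} (hd : DifferentiableAt ℝ (lowerGraph ω h) x) :
    HasDerivAt (fun τ : ℝ => lowerGraph ω (fun v => h v + τ * f v) x)
      (-(f (slopeNormal (fderiv ℝ (lowerGraph ω h) x)) *
        graphDensity (fderiv ℝ (lowerGraph ω h) x))) 0 := by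
  have hneg : ∀ u ∈ ω, height u < 0 := fun u hu => (hω1 hu).2
  set q : Space n → ℝ := fun u => f u / (-height u) with hqdef
  have hq : ContinuousOn q ω :=
    hf.div continuous_height.neg.continuousOn (fun u hu => (neg_pos.2 (hneg u hu)).ne')
  have hgτ : ∀ τ : ℝ, ContinuousOn (fun v => h v + τ * f v) ω := fun τ =>
    hh.add (continuousOn_const.mul hf)
  set F : ℝ → ℝ := fun τ => lowerGraph ω (fun v => h v + τ * f v) x with hF
  have hF0 : F 0 = lowerGraph ω h x := by simp [hF]
  obtain ⟨v, hv, hve⟩ := exists_lowerGraph_eq hω hne hh hneg x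
  have huniq : ∀ u ∈ ω, lowerGraph ω h x = planeFun h u x → u = v := fun u hu he => by
    rw [eq_slopeNormal_of_lowerGraph_eq hω hh hω1 hd hu he,
      eq_slopeNormal_of_lowerGraph_eq hω hh hω1 hd hv hve]
  have hvN := eq_slopeNormal_of_lowerGraph_eq hω hh hω1 hd hv hve
  have hval : f (slopeNormal (fderiv ℝ (lowerGraph ω h) x)) *
      graphDensity (fderiv ℝ (lowerGraph ω h) x) = q v := by
    rw [← hvN, hqdef]
    have : -height v = (graphDensity (fderiv ℝ (lowerGraph ω h) x))⁻¹ := by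
      conv_lhs => rw [hvN, height_slopeNormal, neg_neg]
    simp only [this, div_inv_eq_mul]
  rw [hval]
  choose u hu hue using fun τ : ℝ => exists_lowerGraph_eq hω hne (hgτ τ) hneg x
  have hFu : ∀ τ, F τ = planeFun h (u τ) x - τ * q (u τ) := fun τ => by
    rw [← planeFun_add_mul]; exact hue τ
  obtain ⟨C, hC⟩ := exists_lowerGraph_lipschitz_param hω hne hh hf hneg
  have hFc : Tendsto F (𝓝 0) (𝓝 (F 0)) := (hC x).continuous.tendsto 0
  obtain ⟨Q, hQ⟩ := hω.exists_bound_of_continuousOn hq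
  have hp0 : Tendsto (fun τ => planeFun h (u τ) x) (𝓝 0) (𝓝 (F 0)) := by
    have h1 : Tendsto (fun τ => τ * q (u τ)) (𝓝 0) (𝓝 0) := by
      refine squeeze_zero_norm (a := fun τ => |τ| * Q) (fun τ => ?_) ?_
      · rw [norm_mul, Real.norm_eq_abs]
        gcongr
        exact hQ _ (hu τ)
      · have : Tendsto (fun τ : ℝ => |τ| * Q) (𝓝 0) (𝓝 (|0| * Q)) :=
          Continuous.tendsto (by fun_prop) 0
        simpa using this
    have h2 := hFc.add h1
    rw [add_zero] at h2
    refine h2.congr fun τ => ?_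
    rw [hFu]; ring
  -- Off a neighbourhood of the unique maximiser v, the values of the affine functions stay strictly
  -- below F 0 by compactness, while those at u τ tend to F 0.
  have hulim : Tendsto u (𝓝 0) (𝓝[ω] v) := by
    refine tendsto_nhdsWithin_iff.2 ⟨?_, Eventually.of_forall hu⟩
    refine tendsto_nhds.2 fun V hV hvV => ?_
    rcases (ω \ V).eq_empty_or_nonempty with hem | hnem
    · exact Eventually.of_forall fun τ => by_contra fun hτ =>
        Set.notMem_empty (u τ) (hem ▸ ⟨hu τ, hτ⟩)
    · obtain ⟨m, hm, hmax⟩ := (hω.diff hV).exists_isMaxOn hnem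
        ((continuousOn_planeFun hh hneg x).mono Set.sdiff_subset)
      have hlt : planeFun h m x < F 0 := by
        refine lt_of_le_of_ne (hF0 ▸ planeFun_le_lowerGraph hω hh hneg x hm.1) fun he => ?_
        exact hm.2 (huniq m hm.1 (hF0 ▸ he.symm) ▸ hvV)
      filter_upwards [hp0.eventually (lt_mem_nhds hlt)] with τ hτ
      by_contra hτV
      exact absurd (hmax ⟨hu τ, hτV⟩) (not_le.2 hτ)
  have hqlim : Tendsto (fun τ => q v - q (u τ)) (𝓝 0) (𝓝 0) := by
    have h1 : Tendsto (fun τ => q (u τ)) (𝓝 0) (𝓝 (q v)) := (hq v hv).tendsto.comp hulim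
    simpa using h1.const_sub (q v)
  rw [hasDerivAt_iff_isLittleO]
  -- Testing F τ with v and F 0 with u τ gives 0 ≤ F τ - F 0 + τ q(v) ≤ τ (q(v) - q(u τ)).
  have hb : ∀ τ, ‖F τ - F 0 - (τ - 0) • -q v‖ ≤ 1 * ‖(q v - q (u τ)) * (τ - 0)‖ := by
    intro τ
    have h1 : planeFun h v x - τ * q v ≤ F τ := by
      rw [← planeFun_add_mul]
      exact planeFun_le_lowerGraph hω (hgτ τ) hneg x hv
    have h2 : planeFun h (u τ) x ≤ F 0 := hF0 ▸ planeFun_le_lowerGraph hω hh hneg x (hu τ)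
    have h3 := hFu τ
    have h4 : F 0 = planeFun h v x := hF0.trans hve
    rw [one_mul, Real.norm_eq_abs, Real.norm_eq_abs, smul_eq_mul, sub_zero,
      abs_of_nonneg (by linarith)]
    refine le_trans ?_ (le_abs_self _)
    linarith
  refine (Asymptotics.IsBigO.of_bound 1 (Eventually.of_forall hb)).trans_isLittleO ?_
  have := ((Asymptotics.isLittleO_one_iff ℝ).2 hqlim).mul_isBigO
    (Asymptotics.isBigO_refl (fun τ : ℝ => τ - 0) (𝓝 0))
  simpa using this

/-! ### The cut sets and their coconvex complements. -/

theorem mem_wulffIn {n : ℕ} {K ω : Set (Space n)} {g : Space n → ℝ} {x : Space n} :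
    x ∈ wulffIn K ω g ↔ x ∈ asymptoticSet K ∧ ∀ u ∈ ω, ⟪x, u⟫ ≤ g u := by
  simp [wulffIn]

theorem isClosed_wulffIn {n : ℕ} (K ω : Set (Space n)) (g : Space n → ℝ) :
    IsClosed (wulffIn K ω g) :=
  (isClosed_asymptoticSet K).inter
    (isClosed_biInter fun u _ => isClosed_le (by fun_prop) (by fun_prop))

theorem MemCc.convex_wulffIn {n : ℕ} (hn : 1 ≤ n) {K : Set (Space n)} (hK : MemCc K)
    (ω : Set (Space n)) (g : Space n → ℝ) : Convex ℝ (wulffIn K ω g) := by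
  refine (hK.convex_asymptoticSet hn).inter (convex_iInter₂ fun u _ => ?_)
  intro x hx y hy a b ha hb hab
  change ⟪x, u⟫ ≤ g u at hx
  change ⟪y, u⟫ ≤ g u at hy
  change ⟪a • x + b • y, u⟫ ≤ g u
  rw [inner_add_left, real_inner_smul_left, real_inner_smul_left]
  calc a * ⟪x, u⟫ + b * ⟪y, u⟫ ≤ a * g u + b * g u := by gcongr
    _ = g u := by rw [← add_mul, hab, one_mul]

/-- Non-negative g keeps 0 and everything above some height, so the cut does not change the
asymptotic set. -/
theorem MemCb.coconvexSet_wulffIn {n : ℕ} (hn : 1 ≤ n) {D K ω : Set (Space n)} (hK : MemCb D K)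
    (hω : IsCompact ω) (hωD : ω ⊆ D) {g : Space n → ℝ} (hg : ∀ u ∈ ω, 0 ≤ g u) :
    coconvexSet (wulffIn K ω g) = asymptoticSet K \ wulffIn K ω g := by
  obtain ⟨T, hT⟩ := hK.exists_height_inner_le hn hω hωD 0
  rw [coconvexSet, hK.asymptoticSet_eq hn (isClosed_wulffIn K ω g) (hK.convex_wulffIn hn ω g)
    (fun x hx => (mem_wulffIn.1 hx).1)
    (mem_wulffIn.2 ⟨hK.zero_mem, fun u hu => by rw [inner_zero_left]; exact hg u hu⟩) (T := T)
    (fun x hx hxT => mem_wulffIn.2 ⟨hx, fun u hu => (hT x hx hxT u hu).trans (hg u hu)⟩)]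

theorem MemCb.supportFun_pos_bound {n : ℕ} {D K ω : Set (Space n)} (hK : MemCb D K)
    (hω : IsCompact ω) (hωD : ω ⊆ D) (hpos : ∀ u ∈ ω, 0 < supportFun K u) {f : Space n → ℝ}
    (hf : ContinuousOn f ω) :
    ∃ ε : ℝ, 0 < ε ∧ ∀ τ : ℝ, |τ| < ε → ∀ u ∈ ω, 0 ≤ supportFun K u + τ * f u := by
  have hh : ContinuousOn (supportFun K) ω := hK.continuousOn_supportFun.mono hωD
  obtain ⟨c, hc, hcω⟩ := hω.exists_forall_le' hh hpos
  obtain ⟨M, hM⟩ := hω.exists_bound_of_continuousOn hf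
  refine ⟨c / (|M| + 1), by positivity, fun τ hτ u hu => ?_⟩
  have h1 : |τ * f u| ≤ c := by
    rw [abs_mul]
    calc |τ| * |f u| ≤ c / (|M| + 1) * (|M| + 1) := by
          gcongr
          exact (hM u hu).trans ((le_abs_self M).trans (by linarith))
      _ = c := by field_simp
  linarith [hcω u hu, neg_abs_le (τ * f u)]

/-! ### Vertical sections and Fubini. -/

/-- The measure of the part of `P` below a level, as a function of the level. -/
noncomputable def belowLength (P : Set ℝ) (a : ℝ) : ℝ := volume.real (P ∩ Set.Iio a)

theorem measure_below_lt_top {P : Set ℝ} (hP : P ⊆ Set.Ici 0) (a : ℝ) :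
    volume (P ∩ Set.Iio a) < ⊤ :=
  (measure_mono (fun _ hz => ⟨hP hz.1, hz.2⟩ : P ∩ Set.Iio a ⊆ Set.Ico 0 a)).trans_lt
    measure_Ico_lt_top

theorem belowLength_sub {P : Set ℝ} (hPm : MeasurableSet P) (hP : P ⊆ Set.Ici 0) {a b : ℝ}
    (hab : a ≤ b) : belowLength P b - belowLength P a = volume.real (P ∩ Set.Ico a b) := by
  have hsub : P ∩ Set.Iio a ⊆ P ∩ Set.Iio b :=
    Set.inter_subset_inter_right _ (Set.Iio_subset_Iio hab)
  rw [belowLength, belowLength, ← measureReal_sdiff hsub (hPm.inter measurableSet_Iio)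
    (measure_below_lt_top hP b).ne]
  congr 1
  ext z
  simp only [Set.mem_sdiff, Set.mem_inter_iff, Set.mem_Iio, Set.mem_Ico, not_and, not_lt]
  tauto

theorem lipschitzWith_belowLength {P : Set ℝ} (hPm : MeasurableSet P) (hP : P ⊆ Set.Ici 0) :
    LipschitzWith 1 (belowLength P) := by
  refine LipschitzWith.of_le_add_mul _ fun a b => ?_
  rw [NNReal.coe_one, one_mul, Real.dist_eq]
  rcases le_total a b with hab | hab
  · have h1 := belowLength_sub hPm hP hab
    have h2 : 0 ≤ volume.real (P ∩ Set.Ico a b) := measureReal_nonneg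
    linarith [abs_nonneg (a - b)]
  · have h1 := belowLength_sub hPm hP hab
    have h2 : volume.real (P ∩ Set.Ico b a) ≤ volume.real (Set.Ico b a) :=
      measureReal_mono Set.inter_subset_right measure_Ico_lt_top.ne
    rw [Real.volume_real_Ico_of_le hab] at h2
    linarith [le_abs_self (a - b)]

/-- Near a, P contains an interval, so a change of level changes the length by exactly that amount.
-/
theorem hasDerivAt_belowLength_of_mem {P : Set ℝ} (hPm : MeasurableSet P) (hP : P ⊆ Set.Ici 0)
    {a : ℝ} (ha : P ∈ 𝓝 a) : HasDerivAt (belowLength P) 1 a := by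
  obtain ⟨ε, hε, hball⟩ := Metric.mem_nhds_iff.1 ha
  have h1 : HasDerivAt (fun b : ℝ => belowLength P a + (b - a)) 1 a :=
    ((hasDerivAt_id a).sub_const a).const_add _
  refine h1.congr_of_eventuallyEq ?_
  filter_upwards [Metric.ball_mem_nhds a hε] with b hb
  rw [Real.ball_eq_Ioo] at hball hb
  rcases le_total a b with hab | hab
  · have h2 := belowLength_sub hPm hP hab
    rw [Set.inter_eq_right.2 (fun z hz => hball ⟨by linarith [hz.1], hz.2.trans hb.2⟩),
      Real.volume_real_Ico_of_le hab] at h2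
    linarith
  · have h2 := belowLength_sub hPm hP hab
    rw [Set.inter_eq_right.2 (fun z hz => hball ⟨hb.1.trans_le hz.1, by linarith [hz.2]⟩),
      Real.volume_real_Ico_of_le hab] at h2
    linarith

theorem hasDerivAt_belowLength_of_notMem {P : Set ℝ} (hPm : MeasurableSet P) (hP : P ⊆ Set.Ici 0)
    {a : ℝ} (ha : Pᶜ ∈ 𝓝 a) : HasDerivAt (belowLength P) 0 a := by
  obtain ⟨ε, hε, hball⟩ := Metric.mem_nhds_iff.1 ha
  refine (hasDerivAt_const a (belowLength P a)).congr_of_eventuallyEq ?_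
  filter_upwards [Metric.ball_mem_nhds a hε] with b hb
  rw [Real.ball_eq_Ioo] at hball hb
  rcases le_total a b with hab | hab
  · have h2 := belowLength_sub hPm hP hab
    have h3 : P ∩ Set.Ico a b = ∅ := by
      rw [← Set.disjoint_iff_inter_eq_empty, Set.disjoint_right]
      exact fun z hz => hball ⟨by linarith [hz.1], hz.2.trans hb.2⟩
    rw [h3, measureReal_empty] at h2
    linarith
  · have h2 := belowLength_sub hPm hP hab
    have h3 : P ∩ Set.Ico b a = ∅ := by
      rw [← Set.disjoint_iff_inter_eq_empty, Set.disjoint_right]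
      exact fun z hz => hball ⟨hb.1.trans_le hz.1, by linarith [hz.2]⟩
    rw [h3, measureReal_empty] at h2
    linarith

/-- The vertical section of a set over `x`. -/
def vertSection {n : ℕ} (A : Set (Space n)) (x : Base n) : Set ℝ := {z | join (x, z) ∈ A}

theorem continuous_join_right {n : ℕ} (x : Base n) : Continuous fun z : ℝ => join (x, z) :=
  (join : (Base n × ℝ) ≃L[ℝ] Space n).continuous.comp (by fun_prop)

theorem measurableSet_vertSection {n : ℕ} (K : Set (Space n)) (x : Base n) :
    MeasurableSet (vertSection (asymptoticSet K) x) :=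
  ((isClosed_asymptoticSet K).preimage (continuous_join_right x)).measurableSet

theorem vertSection_subset {n : ℕ} (K : Set (Space n)) (x : Base n) :
    vertSection (asymptoticSet K) x ⊆ Set.Ici 0 := fun z hz => by
  have := height_nonneg_of_mem_asymptoticSet hz
  rwa [height_join] at this

/-- The region of `A(K)` below a graph. -/
theorem measurableSet_below {n : ℕ} (K : Set (Space n)) {G : Base n → ℝ} (hG : Continuous G) :
    MeasurableSet {p : Base n × ℝ | join p ∈ asymptoticSet K ∧ p.2 < G p.1} :=
  ((isClosed_asymptoticSet K).preimage join.continuous).measurableSet.inter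
    (isOpen_lt continuous_snd (hG.comp continuous_fst)).measurableSet

theorem measurable_belowLength {n : ℕ} (K : Set (Space n)) {G : Base n → ℝ} (hG : Continuous G) :
    Measurable fun x => belowLength (vertSection (asymptoticSet K) x) (G x) :=
  (measurable_measure_prodMk_left (ν := volume) (measurableSet_below K hG)).ennreal_toReal

theorem volume_real_below {n : ℕ} (K : Set (Space n)) {G : Base n → ℝ} (hG : Continuous G)
    {S : Set (Space n)} (hS : ∀ x z, join (x, z) ∈ S ↔ join (x, z) ∈ asymptoticSet K ∧ z < G x) :
    volume.real S = ∫ x, belowLength (vertSection (asymptoticSet K) x) (G x) := by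
  have hm := measurableSet_below K hG
  have hpre : join ⁻¹' S = {p : Base n × ℝ | join p ∈ asymptoticSet K ∧ p.2 < G p.1} := by
    ext p
    exact hS p.1 p.2
  have hemb : MeasurableEmbedding (join : Base n × ℝ → Space n) :=
    (join : (Base n × ℝ) ≃L[ℝ] Space n).toHomeomorph.measurableEmbedding
  have hv : volume S = volume {p : Base n × ℝ | join p ∈ asymptoticSet K ∧ p.2 < G p.1} := by
    rw [← hpre, measurePreserving_join.measure_preimage_emb hemb]
  rw [Measure.real, hv, Measure.volume_eq_prod, Measure.prod_apply hm]
  exact (integral_toReal (measurable_measure_prodMk_left hm).aemeasurable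
    (Eventually.of_forall fun x => measure_below_lt_top (vertSection_subset K x) (G x))).symm

theorem exists_ball_of_isBounded {n : ℕ} {S : Set (Space n)} (hS : Bornology.IsBounded S) :
    ∃ R : ℝ, ∀ x ∈ S, horiz x ∈ Metric.closedBall (0 : Base n) R := by
  obtain ⟨R, hR⟩ := hS.exists_norm_le
  exact ⟨R, fun x hx => by
    rw [mem_closedBall_zero_iff]
    exact (norm_horiz_le x).trans (hR x hx)⟩

/-! ### Transversality of the lower graph and the boundary of A(K). -/

/-- A vector orthogonal to the tangent space of a graph is a multiple of a given normal. -/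
theorem exists_smul_eq_of_orthogonal {n : ℕ} {p : Base n →L[ℝ] ℝ} {u v : Space n}
    (hu : height u < 0) (hp : ∀ d, p d * (-height u) = ⟪d, horiz u⟫) (hv : ‖v‖ = 1)
    (h : ∀ d, ⟪join (d, p d), v⟫ = 0) :
    height v ≠ 0 ∧ v = (height v / height u) • u := by
  have heq : v = (height v / height u) • u := by
    refine ext_inner_left ℝ fun y => ?_
    rw [← join_horiz_height y, real_inner_smul_right, inner_join_left, inner_join_left]
    have h1 := h (horiz y)
    have h2 := hp (horiz y)
    rw [inner_join_left] at h1
    have h3 : ⟪horiz y, horiz v⟫ = -(p (horiz y) * height v) := by linarith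
    have h4 : height u ≠ 0 := hu.ne
    rw [← h2, h3]
    field_simp
  refine ⟨fun h0 => ?_, heq⟩
  rw [h0, zero_div, zero_smul] at heq
  rw [heq, norm_zero] at hv
  exact zero_ne_one hv

theorem hasFDerivAt_inner_graphMap {n : ℕ} {G : Base n → ℝ} {x : Base n}
    (hd : DifferentiableAt ℝ G x) (v : Space n) :
    HasFDerivAt (fun y => ⟪graphMap G y, v⟫) ((innerSL ℝ v) ∘L graphLin (fderiv ℝ G x)) x := by
  have h1 : HasFDerivAt (graphMap G) (graphLin (fderiv ℝ G x)) x :=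
    (join : (Base n × ℝ) ≃L[ℝ] Space n).toContinuousLinearMap.hasFDerivAt.comp x
      ((hasFDerivAt_id x).prodMk hd.hasFDerivAt)
  have h2 := (innerSL ℝ v).hasFDerivAt.comp x h1
  refine h2.congr_of_eventuallyEq (Eventually.of_forall fun y => ?_)
  simp only [Function.comp_apply, innerSL_apply_apply]
  exact real_inner_comm _ _

theorem inner_graphMap_eq {n : ℕ} {G : Base n → ℝ} {g : Space n → ℝ} {u : Space n}
    (hu : height u < 0) {x : Base n} (he : G x = planeFun g u x) : ⟪graphMap G x, u⟫ = g u := by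
  rw [graphMap, inner_join_left, he, planeFun]
  have : -height u ≠ 0 := (neg_pos.2 hu).ne'
  have h2 : (⟪x, horiz u⟫ - g u) / (-height u) * (-height u) = ⟪x, horiz u⟫ - g u :=
    div_mul_cancel₀ _ this
  linarith

/-- The lower graph meets the boundary of `A(K)` only over a null set. -/
theorem MemCb.volume_graphMap_frontier {n : ℕ} (hn : 1 ≤ n) {D K ω : Set (Space n)}
    (hK : MemCb D K) (hω : IsCompact ω) (hne : ω.Nonempty) (hωD : ω ⊆ D)
    (hpos : ∀ u ∈ ω, 0 < supportFun K u) :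
    volume {x | graphMap (lowerGraph ω (supportFun K)) x ∈ frontier (asymptoticSet K)} = 0 := by
  have hω1 : ω ⊆ lowerHemisphere n := hωD.trans hK.domain.subset_lower
  have hneg : ∀ u ∈ ω, height u < 0 := fun u hu => (hω1 hu).2
  have hh : ContinuousOn (supportFun K) ω := hK.continuousOn_supportFun.mono hωD
  obtain ⟨C, hC⟩ := exists_lipschitzWith_lowerGraph hω hne hh hω1
  set G := lowerGraph ω (supportFun K) with hG
  set E : Set (Base n) := {x | graphMap G x ∈ frontier (asymptoticSet K)} with hE
  have hEm : MeasurableSet E :=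
    (isClosed_frontier.preimage (continuous_graphMap hC.continuous)).measurableSet
  have hEA : ∀ y ∈ E, graphMap G y ∈ asymptoticSet K := fun y hy =>
    (isClosed_asymptoticSet K).closure_eq ▸ hy.1
  suffices h : ∀ᵐ x ∂volume.restrict E, False by
    simpa using h
  filter_upwards [ae_restrict_mem hEm, ae_restrict_posTangentConeAt_eq_univ volume E,
    ae_restrict_of_ae hC.ae_differentiableAt] with x hx hcone hd
  obtain ⟨u, hu, he⟩ := exists_lowerGraph_eq hω hne hh hneg x
  have hp := fderiv_lowerGraph_mul hω hh hneg hd hu he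
  -- Over E the function ⟨graph, v⟩ is maximal at x. Every direction is tangent to E there, so its
  -- derivative vanishes and v is orthogonal to the tangent space of the graph.
  have key : ∀ v, IsUnitNormal (asymptoticSet K) (graphMap G x) v →
      height v ≠ 0 ∧ v = (height v / height u) • u := by
    intro v hv
    refine exists_smul_eq_of_orthogonal (hneg u hu) hp hv.1 fun d => ?_
    have hmax : IsLocalMaxOn (fun y => ⟪graphMap G y, v⟫) E x :=
      eventually_nhdsWithin_of_forall fun y hy => hv.2 _ (hEA y hy)
    have hder := (hasFDerivAt_inner_graphMap hd v).hasFDerivWithinAt (s := E)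
    have h0 := hmax.hasFDerivWithinAt_eq_zero hder (y := d) (by rw [hcone]; exact Set.mem_univ _)
      (by rw [hcone]; exact Set.mem_univ _)
    rw [ContinuousLinearMap.comp_apply, innerSL_apply_apply, graphLin_apply, real_inner_comm] at h0
    exact h0
  have hxA := hEA x hx
  rcases (height_nonneg_of_mem_asymptoticSet hxA).eq_or_lt with h0 | h0
  -- At height 0 the vector -eₙ₊₁ is a normal, which forces u = -eₙ₊₁. Then h_K(u) ≤ 0, against
  -- positivity on ω.
  · have hv : IsUnitNormal (asymptoticSet K) (graphMap G x) (join (0, -1)) := by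
      have hj : ∀ y : Space n, ⟪y, join (0, -1)⟫ = -height y := fun y => by
        rw [real_inner_comm, inner_join_left, inner_zero_left]; ring
      refine ⟨by rw [norm_join_zero]; simp, fun z hz => ?_⟩
      rw [hj, hj, ← h0]
      linarith [height_nonneg_of_mem_asymptoticSet hz]
    obtain ⟨-, h2⟩ := key _ hv
    rw [height_join] at h2
    have hu0 : height u ≠ 0 := (hneg u hu).ne
    have h3 : u = join (0, height u) := by
      have h4 : (-height u) • (join (0, -1) : Space n) = u := by
        conv_lhs => rw [h2]
        rw [smul_smul]
        have : -height u * (-1 / height u) = 1 := by field_simp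
        rw [this, one_smul]
      rw [← map_smul] at h4
      conv_lhs => rw [← h4]
      simp
    refine absurd (hpos u hu) (not_lt.2 (supportFun_le hK.nonempty fun z hz => ?_))
    rw [h3, real_inner_comm, inner_join_left, inner_zero_left]
    nlinarith [hK.height_nonneg z hz, hneg u hu]
  -- A normal orthogonal to a recession direction would be a non-zero multiple of u ∈ D, against ⟨θ,
  -- u⟩ < 0.
  · obtain ⟨v, θ, hv, hθ, hθ1, hθv⟩ := hK.exists_normal_orthogonal_recession hn hx h0
    obtain ⟨hv0, hvu⟩ := key v hv
    rw [hvu, real_inner_smul_right, mul_eq_zero] at hθv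
    rcases hθv with h1 | h1
    · exact hv0 ((div_eq_zero_iff.1 h1).resolve_right (hneg u hu).ne)
    · exact (hK.inner_neg_of_isRecession hθ hθ1 (hωD hu)).ne h1

theorem MemCb.subset_wulffBase {n : ℕ} {D K ω : Set (Space n)} (hK : MemCb D K) (hωD : ω ⊆ D) :
    K ⊆ wulffBase K ω := fun _ hx =>
  mem_wulffIn.2 ⟨hK.closure_subset (subset_closure hx), fun u hu =>
    inner_le_supportFun (hK.support_finite u (hωD hu)) hx⟩

theorem graphMap_mem_wulffBase {n : ℕ} {K ω : Set (Space n)} (hω : IsCompact ω) (hne : ω.Nonempty)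
    (hh : ContinuousOn (supportFun K) ω) (hneg : ∀ u ∈ ω, height u < 0) {x : Base n} {z : ℝ} :
    join (x, z) ∈ wulffBase K ω ↔
      join (x, z) ∈ asymptoticSet K ∧ lowerGraph ω (supportFun K) x ≤ z := by
  rw [wulffBase, mem_wulffIn, forall_inner_join_le_iff hω hne hh hneg]

/-- Over points of differentiability, the lower graph consists of regular boundary points inside
`A(K)`. -/
theorem MemCb.graphMap_mem_regularBoundary {n : ℕ} {D K ω : Set (Space n)}
    (hK : MemCb D K) (hω : IsCompact ω) (hne : ω.Nonempty) (hωD : ω ⊆ D) {x : Base n}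
    (hd : DifferentiableAt ℝ (lowerGraph ω (supportFun K)) x)
    (hx : graphMap (lowerGraph ω (supportFun K)) x ∈ interior (asymptoticSet K)) :
    graphMap (lowerGraph ω (supportFun K)) x ∈ regularBoundary (wulffBase K ω) ∧
    gaussMap (wulffBase K ω) (graphMap (lowerGraph ω (supportFun K)) x) =
      slopeNormal (fderiv ℝ (lowerGraph ω (supportFun K)) x) ∧
    slopeNormal (fderiv ℝ (lowerGraph ω (supportFun K)) x) ∈ ω := by
  have hω1 : ω ⊆ lowerHemisphere n := hωD.trans hK.domain.subset_lower
  have hneg : ∀ u ∈ ω, height u < 0 := fun u hu => (hω1 hu).2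
  have hh : ContinuousOn (supportFun K) ω := hK.continuousOn_supportFun.mono hωD
  obtain ⟨C, hC⟩ := exists_lipschitzWith_lowerGraph hω hne hh hω1
  set G := lowerGraph ω (supportFun K) with hG
  obtain ⟨u, hu, he⟩ := exists_lowerGraph_eq hω hne hh hneg x
  have huN := eq_slopeNormal_of_lowerGraph_eq hω hh hω1 hd hu he
  have hp := fderiv_lowerGraph_mul hω hh hneg hd hu he
  have hun : IsUnitNormal (wulffBase K ω) (graphMap G x) u := by
    refine ⟨(hω1 hu).1, fun z hz => ?_⟩
    rw [inner_graphMap_eq (hneg u hu) he]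
    exact (mem_wulffIn.1 hz).2 u hu
  have hmem : ∀ y, graphMap G y ∈ asymptoticSet K → graphMap G y ∈ wulffBase K ω := fun y hy =>
    (graphMap_mem_wulffBase hω hne hh hneg).2 ⟨hy, le_rfl⟩
  have hxL : graphMap G x ∈ wulffBase K ω := hmem x (interior_subset hx)
  have huniq : ∀ v, IsUnitNormal (wulffBase K ω) (graphMap G x) v → v = u := by
    intro v hv
    have hev : ∀ᶠ y in 𝓝 x, graphMap G y ∈ interior (asymptoticSet K) :=
      (continuous_graphMap hC.continuous).continuousAt.eventually
        (isOpen_interior.mem_nhds hx)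
    have hmax : IsLocalMax (fun y => ⟪graphMap G y, v⟫) x := by
      filter_upwards [hev] with y hy
      exact hv.2 _ (hmem y (interior_subset hy))
    have h0 := hmax.hasFDerivAt_eq_zero (hasFDerivAt_inner_graphMap hd v)
    obtain ⟨hv0, hvu⟩ := exists_smul_eq_of_orthogonal (hneg u hu) hp hv.1 fun d => by
      have := congrArg (fun L : Base n →L[ℝ] ℝ => L d) h0
      simp only [ContinuousLinearMap.comp_apply, innerSL_apply_apply, graphLin_apply,
        zero_apply] at this
      rw [real_inner_comm]
      exact this
    -- Points just above the graph point still belong to K_ω, so v cannot point upwards; this fixes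
    -- the sign in v = ±u.
    have hvneg : height v ≤ 0 := by
      have hcont : Tendsto (fun ε : ℝ => join (x, G x + ε)) (𝓝[>] 0) (𝓝 (graphMap G x)) := by
        have : Tendsto (fun ε : ℝ => join (x, G x + ε)) (𝓝 0) (𝓝 (join (x, G x + 0))) :=
          ((continuous_join_right x).comp (by fun_prop : Continuous fun ε : ℝ => G x + ε)).tendsto 0
        rw [add_zero] at this
        exact this.mono_left nhdsWithin_le_nhds
      obtain ⟨ε, hε, hε0⟩ := ((hcont.eventually (isOpen_interior.mem_nhds hx)).and
        self_mem_nhdsWithin).exists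
      have hε0' : (0 : ℝ) < ε := hε0
      have h1 := hv.2 _ ((graphMap_mem_wulffBase hω hne hh hneg).2
        ⟨interior_subset hε, by linarith⟩)
      rw [graphMap, inner_join_left, inner_join_left] at h1
      nlinarith
    have hlam : 0 ≤ height v / height u := div_nonneg_of_nonpos hvneg (hneg u hu).le
    have hnorm := hv.1
    rw [hvu, norm_smul, (hω1 hu).1, mul_one, Real.norm_eq_abs, abs_of_nonneg hlam] at hnorm
    rw [hvu, hnorm, one_smul]
  have hreg : graphMap G x ∈ regularBoundary (wulffBase K ω) :=
    ⟨⟨subset_closure hxL, fun hi => lt_irrefl _ (hun.inner_lt_of_mem_interior hi)⟩, u, hun, huniq⟩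
  exact ⟨hreg, (gaussMap_eq_of_isUnitNormal hreg hun).trans huN, huN ▸ hu⟩

/-! ### The surface area measure on ω as an integral over the base. -/

/-- The boundary points of `K_ω` whose normal vector lies in `ω`. -/
def normalPart {n : ℕ} (K ω : Set (Space n)) : Set (Space n) :=
  gaussMap (wulffBase K ω) ⁻¹' ω ∩ regularBoundary (wulffBase K ω)

theorem measurableSet_normalPart {n : ℕ} (K : Set (Space n)) {ω : Set (Space n)}
    (hω : IsCompact ω) : MeasurableSet (normalPart K ω) :=
  (measurable_gaussMap _ hω.measurableSet).inter (measurableSet_regularBoundary _)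

theorem normalPart_subset_wulffBase {n : ℕ} (K ω : Set (Space n)) :
    normalPart K ω ⊆ wulffBase K ω := by
  have hc : IsClosed (wulffBase K ω) := isClosed_wulffIn K ω _
  intro y hy
  rw [← hc.closure_eq]
  exact hy.2.1.1

/-- The constraint for the normal gives ≤; since K lies in K_ω, the supporting half-space at y gives
≥. So y lies on an active constraint, hence on the lower graph. -/
theorem MemCb.inner_gaussMap_eq {n : ℕ} {D K ω : Set (Space n)} (hK : MemCb D K) (hωD : ω ⊆ D)
    {y : Space n} (hy : y ∈ normalPart K ω) :
    ⟪y, gaussMap (wulffBase K ω) y⟫ = supportFun K (gaussMap (wulffBase K ω) y) := by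
  refine le_antisymm ((mem_wulffIn.1 (normalPart_subset_wulffBase K ω hy)).2 _ hy.1) ?_
  exact supportFun_le hK.nonempty fun z hz =>
    (gaussMap_isUnitNormal hy.2).2 z (hK.subset_wulffBase hωD hz)

theorem MemCb.normalPart_subset_range {n : ℕ} {D K ω : Set (Space n)} (hK : MemCb D K)
    (hω : IsCompact ω) (hne : ω.Nonempty) (hωD : ω ⊆ D) :
    normalPart K ω ⊆ Set.range (graphMap (lowerGraph ω (supportFun K))) := by
  intro y hy
  have hneg : ∀ u ∈ ω, height u < 0 := fun u hu => (hK.domain.subset_lower (hωD hu)).2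
  have hh : ContinuousOn (supportFun K) ω := hK.continuousOn_supportFun.mono hωD
  refine ⟨horiz y, ?_⟩
  have hyL := normalPart_subset_wulffBase K ω hy
  have h1 := hK.inner_gaussMap_eq hωD hy
  rw [← join_horiz_height y] at hyL
  have hle := ((graphMap_mem_wulffBase hω hne hh hneg).1 hyL).2
  have hge : height y ≤ lowerGraph ω (supportFun K) (horiz y) := by
    refine le_trans ?_ (planeFun_le_lowerGraph hω hh hneg (horiz y) hy.1)
    have hu := hneg _ hy.1
    set u := gaussMap (wulffBase K ω) y
    rw [← join_horiz_height y, inner_join_left] at h1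
    rw [planeFun, le_div_iff₀ (neg_pos.2 hu)]
    linarith
  rw [graphMap, le_antisymm hle hge, join_horiz_height]

/-- On this part ⟨y, u⟩ = h_K(u) > 0 for some u ∈ ω, which is impossible above the height where all
such products are non-positive. -/
theorem MemCb.isBounded_normalPart {n : ℕ} (hn : 1 ≤ n) {D K ω : Set (Space n)} (hK : MemCb D K)
    (hω : IsCompact ω) (hωD : ω ⊆ D) (hpos : ∀ u ∈ ω, 0 < supportFun K u) :
    Bornology.IsBounded (normalPart K ω) := by
  obtain ⟨T, hT⟩ := hK.exists_height_inner_le hn hω hωD 0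
  refine (hK.isBounded_slab hn T).subset fun y hy => ?_
  have hyA := (mem_wulffIn.1 (normalPart_subset_wulffBase K ω hy)).1
  refine ⟨hyA, ?_⟩
  by_contra hlt
  have h1 := hT y hyA (not_le.1 hlt).le _ hy.1
  rw [hK.inner_gaussMap_eq hωD hy] at h1
  linarith [hpos _ hy.1]

theorem surfaceAreaMeasure_restrict {n : ℕ} (K : Set (Space n)) {ω : Set (Space n)}
    (hω : IsCompact ω) :
    (surfaceAreaMeasure (wulffBase K ω)).restrict ω =
      Measure.map (gaussMap (wulffBase K ω))
        ((μHE[n] : Measure (Space n)).restrict (normalPart K ω)) := by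
  rw [surfaceAreaMeasure, Measure.restrict_map (measurable_gaussMap _) hω.measurableSet,
    Measure.restrict_restrict (measurable_gaussMap _ hω.measurableSet), normalPart]

theorem MemCb.restrict_normalPart {n : ℕ} {D K ω : Set (Space n)} (hK : MemCb D K)
    (hω : IsCompact ω) (hne : ω.Nonempty) (hωD : ω ⊆ D) :
    (μHE[n] : Measure (Space n)).restrict (normalPart K ω) =
      (Measure.map (graphMap (lowerGraph ω (supportFun K))) (volume.withDensity fun x =>
        ENNReal.ofReal (graphDensity (fderiv ℝ (lowerGraph ω (supportFun K)) x)))).restrict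
        (normalPart K ω) := by
  have hω1 : ω ⊆ lowerHemisphere n := hωD.trans hK.domain.subset_lower
  have hh : ContinuousOn (supportFun K) ω := hK.continuousOn_supportFun.mono hωD
  obtain ⟨C, hC⟩ := exists_lipschitzWith_lowerGraph hω hne hh hω1
  rw [← comap_graphMap_euclideanHausdorffMeasure hC,
    (measurableEmbedding_graphMap hC.continuous).map_comap,
    Measure.restrict_restrict (measurableSet_normalPart K hω),
    Set.inter_eq_left.2 (hK.normalPart_subset_range hω hne hωD)]

/-- The relevant boundary part lies on a Lipschitz graph over a ball, with density at most √(1 +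
C²). -/
theorem MemCb.surfaceAreaMeasure_lt_top {n : ℕ} (hn : 1 ≤ n) {D K ω : Set (Space n)}
    (hK : MemCb D K) (hω : IsCompact ω) (hne : ω.Nonempty) (hωD : ω ⊆ D)
    (hpos : ∀ u ∈ ω, 0 < supportFun K u) :
    surfaceAreaMeasure (wulffBase K ω) ω < ⊤ := by
  have hω1 : ω ⊆ lowerHemisphere n := hωD.trans hK.domain.subset_lower
  have hh : ContinuousOn (supportFun K) ω := hK.continuousOn_supportFun.mono hωD
  obtain ⟨C, hC⟩ := exists_lipschitzWith_lowerGraph hω hne hh hω1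
  have hemb := measurableEmbedding_graphMap hC.continuous
  obtain ⟨R, hR⟩ := exists_ball_of_isBounded (hK.isBounded_normalPart hn hω hωD hpos)
  have h1 := congrArg (fun μ : Measure (Space n) => μ Set.univ) (surfaceAreaMeasure_restrict K hω)
  simp only [Measure.restrict_apply_univ] at h1
  rw [h1, Measure.map_apply (measurable_gaussMap _) MeasurableSet.univ, Set.preimage_univ,
    hK.restrict_normalPart hω hne hωD, Measure.restrict_apply_univ, hemb.map_apply,
    withDensity_apply _ (hemb.measurable (measurableSet_normalPart K hω))]
  have hsub : graphMap (lowerGraph ω (supportFun K)) ⁻¹' normalPart K ω ⊆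
      Metric.closedBall (0 : Base n) R := fun x hx => by
    have := hR _ hx
    rwa [horiz_graphMap] at this
  refine (lintegral_mono (g := fun _ => ENNReal.ofReal (√(1 + (C : ℝ) ^ 2))) fun x => ?_).trans_lt ?_
  · refine ENNReal.ofReal_le_ofReal (Real.sqrt_le_sqrt ?_)
    gcongr
    exact norm_fderiv_le_of_lipschitz ℝ hC
  · rw [setLIntegral_const]
    exact ENNReal.mul_lt_top ENNReal.ofReal_lt_top
      ((measure_mono hsub).trans_lt measure_closedBall_lt_top)

theorem MemCb.integrableOn_surfaceAreaMeasure {n : ℕ} (hn : 1 ≤ n) {D K ω : Set (Space n)}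
    (hK : MemCb D K) (hω : IsCompact ω) (hne : ω.Nonempty) (hωD : ω ⊆ D)
    (hpos : ∀ u ∈ ω, 0 < supportFun K u) {f : Space n → ℝ} (hf : ContinuousOn f ω) :
    IntegrableOn f ω (surfaceAreaMeasure (wulffBase K ω)) := by
  obtain ⟨M, hM⟩ := hω.exists_bound_of_continuousOn hf
  have : IsFiniteMeasure ((surfaceAreaMeasure (wulffBase K ω)).restrict ω) :=
    isFiniteMeasure_restrict.2 (hK.surfaceAreaMeasure_lt_top hn hω hne hωD hpos).ne
  refine Integrable.of_bound (hf.aestronglyMeasurable hω.measurableSet) M ?_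
  filter_upwards [ae_restrict_mem hω.measurableSet] with u hu
  exact hM u hu

/-- The integral over the surface area measure as an integral over the base. -/
theorem MemCb.setIntegral_surfaceAreaMeasure {n : ℕ} (hn : 1 ≤ n) {D K ω : Set (Space n)}
    (hK : MemCb D K) (hω : IsCompact ω) (hne : ω.Nonempty) (hωD : ω ⊆ D)
    (hpos : ∀ u ∈ ω, 0 < supportFun K u) {f : Space n → ℝ} (hf : ContinuousOn f ω) :
    ∫ u in ω, f u ∂(surfaceAreaMeasure (wulffBase K ω)) =
      ∫ x in {x | graphMap (lowerGraph ω (supportFun K)) x ∈ interior (asymptoticSet K)},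
        f (slopeNormal (fderiv ℝ (lowerGraph ω (supportFun K)) x)) *
          graphDensity (fderiv ℝ (lowerGraph ω (supportFun K)) x) := by
  have hω1 : ω ⊆ lowerHemisphere n := hωD.trans hK.domain.subset_lower
  have hh : ContinuousOn (supportFun K) ω := hK.continuousOn_supportFun.mono hωD
  obtain ⟨C, hC⟩ := exists_lipschitzWith_lowerGraph hω hne hh hω1
  have hemb := measurableEmbedding_graphMap hC.continuous
  have hnull := hK.volume_graphMap_frontier hn hω hne hωD hpos
  set G := lowerGraph ω (supportFun K) with hG
  set U : Set (Base n) := {x | graphMap G x ∈ interior (asymptoticSet K)} with hU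
  have hUm : MeasurableSet U :=
    (isOpen_interior.preimage (continuous_graphMap hC.continuous)).measurableSet
  have hSm := measurableSet_normalPart K hω
  have hfm : AEStronglyMeasurable f (Measure.map (gaussMap (wulffBase K ω))
      ((μHE[n] : Measure (Space n)).restrict (normalPart K ω))) := by
    rw [← surfaceAreaMeasure_restrict K hω]
    exact hf.aestronglyMeasurable hω.measurableSet
  -- Both inclusions hold off the null sets where the graph meets ∂A(K) or G is not differentiable.
  have hset : graphMap G ⁻¹' normalPart K ω =ᵐ[volume] U := by
    rw [Filter.eventuallyEq_set]
    have hnull' : ∀ᵐ x ∂(volume : Measure (Base n)), graphMap G x ∉ frontier (asymptoticSet K) := by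
      rw [ae_iff]; simpa using hnull
    filter_upwards [hnull', hC.ae_differentiableAt] with x hx hd
    constructor
    · intro hxS
      have hxA := (mem_wulffIn.1 (normalPart_subset_wulffBase K ω hxS)).1
      by_contra hi
      exact hx ⟨subset_closure hxA, hi⟩
    · intro hxU
      obtain ⟨h1, h2, h3⟩ := hK.graphMap_mem_regularBoundary hω hne hωD hd hxU
      refine ⟨?_, h1⟩
      change gaussMap (wulffBase K ω) (graphMap G x) ∈ ω
      rw [h2]
      exact h3
  rw [surfaceAreaMeasure_restrict K hω, integral_map (measurable_gaussMap _).aemeasurable hfm,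
    hK.restrict_normalPart hω hne hωD, hemb.setIntegral_map, restrict_withDensity (hemb.measurable hSm),
    integral_withDensity_eq_integral_toReal_smul
      (measurable_graphDensity_fderiv G).ennreal_ofReal
      (Eventually.of_forall fun x => ENNReal.ofReal_lt_top),
    setIntegral_congr_set hset]
  refine setIntegral_congr_ae hUm ?_
  filter_upwards [hC.ae_differentiableAt] with x hd hxU
  obtain ⟨-, h2, -⟩ := hK.graphMap_mem_regularBoundary hω hne hωD hd hxU
  rw [h2, ENNReal.toReal_ofReal (zero_le_one.trans (one_le_graphDensity _)), smul_eq_mul, mul_comm]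

/-! ### Differentiation of the covolume. -/

theorem wulffVar_zero {n : ℕ} (K ω : Set (Space n)) (f : Space n → ℝ) :
    wulffVar K ω f 0 = wulffBase K ω := by
  simp [wulffVar, wulffBase]

theorem MemCb.volume_coconvexSet_wulffIn_lt_top {n : ℕ} (hn : 1 ≤ n) {D K ω : Set (Space n)}
    (hK : MemCb D K) (hω : IsCompact ω) (hωD : ω ⊆ D) {g : Space n → ℝ} (hg : ∀ u ∈ ω, 0 ≤ g u) :
    volume (coconvexSet (wulffIn K ω g)) < ⊤ := by
  obtain ⟨T, hT⟩ := hK.exists_height_inner_le hn hω hωD 0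
  refine ((hK.isBounded_slab hn T).subset ?_).measure_lt_top
  rw [hK.coconvexSet_wulffIn hn hω hωD hg]
  rintro x ⟨hxA, hx⟩
  refine ⟨hxA, ?_⟩
  by_contra hlt
  exact hx (mem_wulffIn.2 ⟨hxA, fun u hu => (hT x hxA (not_le.1 hlt).le u hu).trans (hg u hu)⟩)

theorem measurable_slopeNormal_fderiv {n : ℕ} (G : Base n → ℝ) :
    Measurable fun x => slopeNormal (fderiv ℝ G x) := by
  unfold slopeNormal
  refine (measurable_graphDensity_fderiv G).inv.smul ?_
  have hc : Continuous fun p : Base n →L[ℝ] ℝ =>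
      (join ((InnerProductSpace.toDual ℝ (Base n)).symm p, -1) : Space n) :=
    (join : (Base n × ℝ) ≃L[ℝ] Space n).continuous.comp
      ((LinearIsometryEquiv.continuous _).prodMk continuous_const)
  exact hc.measurable.comp (measurable_fderiv ℝ G)

theorem hasDerivAt_belowLength_comp {P : Set ℝ} (hPm : MeasurableSet P) (hP : P ⊆ Set.Ici 0)
    {γ : ℝ → ℝ} {γ' : ℝ} (hγ : HasDerivAt γ γ' 0) :
    (P ∈ 𝓝 (γ 0) → HasDerivAt (fun τ => belowLength P (γ τ)) γ' 0) ∧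
      (Pᶜ ∈ 𝓝 (γ 0) → HasDerivAt (fun τ => belowLength P (γ τ)) 0 0) := by
  constructor
  · intro h
    simpa using! (hasDerivAt_belowLength_of_mem hPm hP h).comp 0 hγ
  · intro h
    simpa using! (hasDerivAt_belowLength_of_notMem hPm hP h).comp 0 hγ

/-- The variational formula for a non-empty set of normal vectors. -/
theorem MemCb.hasDerivAt_volume_coconvexSet {n : ℕ} (hn : 1 ≤ n) {D K ω : Set (Space n)}
    (hK : MemCb D K) (hω : IsCompact ω) (hne : ω.Nonempty) (hωD : ω ⊆ D)
    (hpos : ∀ u ∈ ω, 0 < supportFun K u) {f : Space n → ℝ} (hf : ContinuousOn f ω) :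
    HasDerivAt (fun τ : ℝ => volume.real (coconvexSet (wulffVar K ω f τ)))
      (-∫ u in ω, f u ∂(surfaceAreaMeasure (wulffBase K ω))) 0 := by
  classical
  have hω1 : ω ⊆ lowerHemisphere n := hωD.trans hK.domain.subset_lower
  have hneg : ∀ u ∈ ω, height u < 0 := fun u hu => (hω1 hu).2
  have hh : ContinuousOn (supportFun K) ω := hK.continuousOn_supportFun.mono hωD
  obtain ⟨ε, hε, hgε⟩ := hK.supportFun_pos_bound hω hωD hpos hf
  obtain ⟨T, hT⟩ := hK.exists_height_inner_le hn hω hωD 0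
  obtain ⟨R, hR⟩ := exists_ball_of_isBounded (hK.isBounded_slab hn T)
  obtain ⟨C, hC⟩ := exists_lipschitzWith_lowerGraph hω hne hh hω1
  obtain ⟨B, hB⟩ := exists_lowerGraph_lipschitz_param hω hne hh hf hneg
  have hgτ : ∀ τ : ℝ, ContinuousOn (fun v => supportFun K v + τ * f v) ω := fun τ =>
    hh.add (continuousOn_const.mul hf)
  have hGc : ∀ τ : ℝ, Continuous (lowerGraph ω (fun v => supportFun K v + τ * f v)) := fun τ => by
    obtain ⟨C', hC'⟩ := exists_lipschitzWith_lowerGraph hω hne (hgτ τ) hω1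
    exact hC'.continuous
  set Γ : ℝ → Base n → ℝ := fun τ => lowerGraph ω (fun v => supportFun K v + τ * f v) with hΓ
  set G := lowerGraph ω (supportFun K) with hG
  have hΓ0 : Γ 0 = G := by simp [hΓ, hG]
  set P : Base n → Set ℝ := fun x => vertSection (asymptoticSet K) x with hP
  have hPm : ∀ x, MeasurableSet (P x) := measurableSet_vertSection K
  have hP0 : ∀ x, P x ⊆ Set.Ici 0 := vertSection_subset K
  set F : ℝ → Base n → ℝ := fun τ x => belowLength (P x) (Γ τ x) with hF
  set U : Set (Base n) := {x | graphMap G x ∈ interior (asymptoticSet K)} with hU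
  have hUm : MeasurableSet U :=
    (isOpen_interior.preimage (continuous_graphMap hC.continuous)).measurableSet
  set s : Set ℝ := Metric.ball 0 ε with hs
  have hsε : ∀ τ ∈ s, |τ| < ε := fun τ hτ => by simpa [hs] using hτ
  have hV : ∀ τ ∈ s, volume.real (coconvexSet (wulffVar K ω f τ)) = ∫ x, F τ x := by
    intro τ hτ
    refine volume_real_below K (hGc τ) fun x z => ?_
    rw [wulffVar, hK.coconvexSet_wulffIn hn hω hωD (hgε τ (hsε τ hτ)), Set.mem_sdiff, mem_wulffIn,
      forall_inner_join_le_iff hω hne (hgτ τ) hneg]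
    constructor
    · rintro ⟨h1, h2⟩
      exact ⟨h1, not_le.1 fun h => h2 ⟨h1, h⟩⟩
    · rintro ⟨h1, h2⟩
      exact ⟨h1, fun h => absurd h2 (not_lt.2 h.2)⟩
  -- A point of A(K) below the graph violates a constraint, so its height is at most T and its
  -- horizontal part lies in the ball of radius R.
  have hzero : ∀ τ ∈ s, ∀ x ∉ Metric.closedBall (0 : Base n) R, F τ x = 0 := by
    intro τ hτ x hx
    have hemp : P x ∩ Set.Iio (Γ τ x) = ∅ := by
      refine Set.eq_empty_of_forall_notMem ?_
      rintro z ⟨hz, hzΓ⟩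
      have hmem : join (x, z) ∈ asymptoticSet K ∩ {x | height x ≤ T} := by
        refine ⟨hz, ?_⟩
        by_contra hlt
        refine absurd hzΓ (not_lt.2 ((forall_inner_join_le_iff hω hne (hgτ τ) hneg x z).1 ?_))
        exact fun u hu => (hT _ hz (not_le.1 hlt).le u hu).trans (hgε τ (hsε τ hτ) u hu)
      have := hR _ hmem
      rw [horiz_join] at this
      exact hx this
    simp only [hF, belowLength, hemp, measureReal_empty]
  have hT' : ∀ x, 0 ≤ F 0 x ∧ F 0 x ≤ |T| := by
    intro x
    refine ⟨measureReal_nonneg, ?_⟩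
    have hsub : P x ∩ Set.Iio (Γ 0 x) ⊆ Set.Icc 0 |T| := by
      rintro z ⟨hz, hzΓ⟩
      refine ⟨hP0 x hz, ?_⟩
      by_contra hlt
      refine absurd hzΓ (not_lt.2 ((forall_inner_join_le_iff hω hne (hgτ 0) hneg x z).1 ?_))
      intro u hu
      refine (hT _ hz ?_ u hu).trans (hgε 0 (by simpa using hε) u hu)
      rw [height_join]
      exact (le_abs_self T).trans (not_le.1 hlt).le
    have h1 : F 0 x ≤ volume.real (Set.Icc 0 |T|) := measureReal_mono hsub measure_Icc_lt_top.ne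
    rwa [Real.volume_real_Icc_of_le (abs_nonneg T), sub_zero] at h1
  have hFm : ∀ τ, Measurable (F τ) := fun τ => measurable_belowLength K (hGc τ)
  have hFint : Integrable (F 0) := by
    have hon : IntegrableOn (F 0) (Metric.closedBall 0 R) := by
      refine Measure.integrableOn_of_bounded measure_closedBall_lt_top.ne
        (hFm 0).aestronglyMeasurable (M := |T|) (Eventually.of_forall fun x => ?_)
      rw [Real.norm_eq_abs, abs_of_nonneg (hT' x).1]
      exact (hT' x).2
    exact hon.integrable_of_forall_notMem_eq_zero (hzero 0 (by simpa [hs] using hε))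
  -- Only the restriction of f to ω is known to be measurable. Extension by zero suffices, because N
  -- lies in ω at differentiability points in U.
  set f₀ : Space n → ℝ := ω.piecewise f (fun _ => 0) with hf₀
  have hf₀m : Measurable f₀ := hf.measurable_piecewise continuousOn_const hω.measurableSet
  set F' : Base n → ℝ := U.indicator fun x =>
    -(f₀ (slopeNormal (fderiv ℝ G x)) * graphDensity (fderiv ℝ G x)) with hF'
  have hF'm : Measurable F' :=
    ((hf₀m.comp (measurable_slopeNormal_fderiv G)).mul
      (measurable_graphDensity_fderiv G)).neg.indicator hUm
  have hnull : ∀ᵐ x ∂(volume : Measure (Base n)), graphMap G x ∉ frontier (asymptoticSet K) := by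
    have := hK.volume_graphMap_frontier hn hω hne hωD hpos
    rw [ae_iff]; simpa using this
  have hf₀eq : ∀ x ∈ U, DifferentiableAt ℝ G x →
      f₀ (slopeNormal (fderiv ℝ G x)) = f (slopeNormal (fderiv ℝ G x)) := fun x hx hd =>
    Set.piecewise_eq_of_mem _ _ _ (hK.graphMap_mem_regularBoundary hω hne hωD hd hx).2.2
  -- Almost every graph point is interior to A(K) or outside it, so the section length has either
  -- the derivative of Γ or derivative 0.
  have hdiff : ∀ᵐ x ∂(volume : Measure (Base n)), HasDerivAt (fun τ => F τ x) (F' x) 0 := by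
    filter_upwards [hnull, hC.ae_differentiableAt] with x hx hd
    have hγ := hasDerivAt_lowerGraph hω hne hh hf hω1 hd
    obtain ⟨hin, hout⟩ := hasDerivAt_belowLength_comp (hPm x) (hP0 x) hγ
    have hΓx : Γ 0 x = G x := congrFun hΓ0 x
    have hcont := (continuous_join_right x).continuousAt (x := G x)
    by_cases hxU : x ∈ U
    · rw [hF', Set.indicator_of_mem hxU, hf₀eq x hxU hd]
      refine hin ?_
      change P x ∈ 𝓝 (Γ 0 x)
      rw [hΓx]
      exact hcont.preimage_mem_nhds (mem_interior_iff_mem_nhds.1 hxU)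
    · rw [hF', Set.indicator_of_notMem hxU]
      refine hout ?_
      change (P x)ᶜ ∈ 𝓝 (Γ 0 x)
      rw [hΓx]
      have hnot : graphMap G x ∈ (asymptoticSet K)ᶜ := fun hA => hx ⟨subset_closure hA, hxU⟩
      exact hcont.preimage_mem_nhds ((isClosed_asymptoticSet K).isOpen_compl.mem_nhds hnot)
  set bound : Base n → ℝ := (Metric.closedBall (0 : Base n) R).indicator fun _ => (B : ℝ) with hbound
  have hbint : Integrable bound :=
    (integrableOn_const measure_closedBall_lt_top.ne).integrable_indicator measurableSet_closedBall
  have hlip : ∀ x, LipschitzOnWith (Real.nnabs (bound x)) (fun τ => F τ x) s := by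
    intro x
    by_cases hx : x ∈ Metric.closedBall (0 : Base n) R
    · have h1 : LipschitzWith (1 * B) (fun τ => F τ x) :=
        (lipschitzWith_belowLength (hPm x) (hP0 x)).comp (hB x)
      have h2 : Real.nnabs (bound x) = 1 * B := by
        rw [hbound, Set.indicator_of_mem hx, one_mul]
        ext; simp
      rw [h2]
      exact h1.lipschitzOnWith
    · refine LipschitzOnWith.of_dist_le_mul fun τ hτ σ hσ => ?_
      rw [hzero τ hτ x hx, hzero σ hσ x hx, dist_self]
      positivity
  have hsn : s ∈ 𝓝 (0 : ℝ) := Metric.ball_mem_nhds 0 hε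
  obtain ⟨-, hmain⟩ := hasDerivAt_integral_of_dominated_loc_of_lip (μ := volume) (F := F)
    (F' := F') (x₀ := (0 : ℝ)) hsn (Eventually.of_forall fun τ => (hFm τ).aestronglyMeasurable)
    hFint hF'm.aestronglyMeasurable (Eventually.of_forall hlip) hbint hdiff
  have hval : ∫ x, F' x = -∫ u in ω, f u ∂(surfaceAreaMeasure (wulffBase K ω)) := by
    rw [hK.setIntegral_surfaceAreaMeasure hn hω hne hωD hpos hf, ← integral_neg, hF',
      integral_indicator hUm]
    refine setIntegral_congr_ae hUm ?_
    filter_upwards [hC.ae_differentiableAt] with x hd hxU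
    rw [hf₀eq x hxU hd]
  rw [← hval]
  refine hmain.congr_of_eventuallyEq ?_
  filter_upwards [hsn] with τ hτ
  exact hV τ hτ

theorem MemCb.coconvexSet_wulffIn_empty {n : ℕ} (hn : 1 ≤ n) {D K : Set (Space n)}
    (hK : MemCb D K) (g : Space n → ℝ) : coconvexSet (wulffIn K ∅ g) = ∅ := by
  rw [hK.coconvexSet_wulffIn hn isCompact_empty (Set.empty_subset D) (by simp)]
  simp [wulffIn]

end Coconvex

theorem mainTheorem2 (n : ℕ) (hn : 1 ≤ n) (D K ω : Set (Coconvex.Space n))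
    (hK : Coconvex.MemCb D K) (hω : IsCompact ω) (hωD : ω ⊆ D)
    (hpos : ∀ u ∈ ω, 0 < Coconvex.supportFun K u)
    (f : Coconvex.Space n → ℝ) (hf : ContinuousOn f ω) :
    (∀ᶠ τ in 𝓝 (0 : ℝ), volume (Coconvex.coconvexSet (Coconvex.wulffVar K ω f τ)) < ⊤) ∧
    volume (Coconvex.coconvexSet (Coconvex.wulffBase K ω)) < ⊤ ∧
    IntegrableOn f ω (Coconvex.surfaceAreaMeasure (Coconvex.wulffBase K ω)) ∧
    HasDerivAt (fun τ : ℝ => volume.real (Coconvex.coconvexSet (Coconvex.wulffVar K ω f τ)))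
      (-∫ u in ω, f u ∂(Coconvex.surfaceAreaMeasure (Coconvex.wulffBase K ω))) 0 ∧
    Tendsto
      (fun τ : ℝ => (volume.real (Coconvex.coconvexSet (Coconvex.wulffVar K ω f τ)) -
        volume.real (Coconvex.coconvexSet (Coconvex.wulffBase K ω))) / τ)
      (𝓝[≠] 0)
      (𝓝 (-∫ u in ω, f u ∂(Coconvex.surfaceAreaMeasure (Coconvex.wulffBase K ω)))) := by
  have hderiv : HasDerivAt
      (fun τ : ℝ => volume.real (Coconvex.coconvexSet (Coconvex.wulffVar K ω f τ)))
      (-∫ u in ω, f u ∂(Coconvex.surfaceAreaMeasure (Coconvex.wulffBase K ω))) 0 := by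
    -- For empty ω the supremum in `lowerGraph` takes the default value 0 and does not describe the
    -- intersection; but then nothing is cut off and both sides vanish.
    rcases ω.eq_empty_or_nonempty with rfl | hne
    · simp only [Coconvex.wulffVar, hK.coconvexSet_wulffIn_empty hn, measureReal_empty,
        Measure.restrict_empty, integral_zero_measure, neg_zero]
      exact hasDerivAt_const 0 0
    · exact hK.hasDerivAt_volume_coconvexSet hn hω hne hωD hpos hf
  refine ⟨?_, hK.volume_coconvexSet_wulffIn_lt_top hn hω hωD fun u hu => (hpos u hu).le, ?_,
    hderiv, ?_⟩
  · obtain ⟨ε, hε, hgε⟩ := hK.supportFun_pos_bound hω hωD hpos hf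
    filter_upwards [Metric.ball_mem_nhds (0 : ℝ) hε] with τ hτ
    exact hK.volume_coconvexSet_wulffIn_lt_top hn hω hωD (hgε τ (by simpa using hτ))
  · rcases ω.eq_empty_or_nonempty with rfl | hne
    · exact integrableOn_empty
    · exact hK.integrableOn_surfaceAreaMeasure hn hω hne hωD hpos hf
  · refine hderiv.tendsto_slope_zero.congr fun τ => ?_
    rw [zero_add, Coconvex.wulffVar_zero, smul_eq_mul, div_eq_inv_mul]
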